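/- **Setting.** There are $M$ messages and $K$ contexts, and one user arrives per timeslot $t=1,2,\dots$ (no broadcasting). The contexts $x_t\in\{1,\dots,K\}$ are i.i.d. and uniform. The server sees $x_t$, recommends a message $a_t$ on the basis of the past and of $x_t$ (and possibly of additional independent randomness), and observes the payoff $r_t(x_t,a_t)$. The payoffs $r_t(k,m)\in[0,1]$ are i.i.d. over time with an unknown law $P_{k,m}$ and are independent of the past and of $x_t$; $\mu(k,m)$ is the mean of $P_{k,m}$. The means only take values in $\{\Delta,2\Delta,3\Delta,\dots\}\cap[0,1]$, where $\Delta\ge\underline\Delta$ and $\underline\Delta>0$ is a constant known to the server. The messages are partitioned into $L$ nonempty content types, unknown to the server, such that for every context $k$ two messages $m_1,m_2$ are of the same type if and only if $\mu(k,m_1)=\mu(k,m_2)$. The regret is $R(T)=\mathbb E\big[\sum_{t=1}^T\max_m\mu(x_t,m)-\sum_{t=1}^T r_t(x_t,a_t)\big]$. **Algorithm 2.** *Initialization.* Let $s$ be the least integer for which there are $K$ sets of $s$ messages each that together cover all pairs of messages (each pair is contained in one of the sets). Fix such sets $\mathcal S_1,\dots,\mathcal S_K$, allocate $\mathcal S_k$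 to context $k$, and assign each pair $\{m_1,m_2\}$ to one context $x_{m_1,m_2}$ whose set contains it. Fix, for each partition of the messages, a set consisting of one representative of each class. *Timeslot $t$.* Let $Z(k,m)$ be the number of times message $m$ was recommended in context $k$ before slot $t$, $\bar r(k,m)$ the average of the payoffs observed then ($0$ if $Z(k,m)=0$), and $D(t)=\frac{32}{\underline\Delta^2}\log t$. Let $k=x_t$. (1) If some $m\in\mathcal S_k$ has $Z(k,m)<D(t)$, recommend any such $m$. (2) Otherwise cluster the messages: start with singletons; let the distance of two clusters be the maximum of $|\bar r(x_{m_1,m_2},m_1)-\bar r(x_{m_1,m_2},m_2)|$ over $m_1$ in the one and $m_2$ in the other; as long as the smallest distance of two different clusters is less than $\underline\Delta/2$, merge two clusters at smallest distance. Take the representatives of the resulting partition. If some representative $m$ has $Z(k,m)<D(t)$, recommend any such $m$. (3) Otherwise recommend a representative that maximizes $\bar r(k,\cdot)$. All ties are broken arbitrarily. **Theorem.** For every $\underline\Delta>0$ there is a constant $C$, depending only on $\underline\Delta$, such that for all $K,M,L$, all payoff laws as above, every possible choice in the initialization, every way of breaking ties, and all $T\ge2$, $$R(T)\le C\left(KM\sqrt{\frac{\log(MK)}{K}}+KL\right)\log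 T .$$ -/

import Mathlib

open MeasureTheory ProbabilityTheory

noncomputable section

namespace LatentBandit

/-! ### The environment

Contexts are `Fin K`, messages are `Fin M`, timeslots are `1, 2, 3, …` (index `0` of every
sequence is unused). -/

/-- The average payoff `μ(k, m)` of message `m` in context `k`, for payoff laws `P k m`. -/
def meanPayoff {K M : ℕ} (P : Fin K → Fin M → Measure ℝ) (k : Fin K) (m : Fin M) : ℝ :=
  ∫ y, y ∂(P k m)

/-- Payoffs are random variables with values in `[0, 1]`. -/
def IsPayoffLaw {K M : ℕ} (P : Fin K → Fin M → Measure ℝ) : Prop :=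
  ∀ k m, IsProbabilityMeasure (P k m) ∧ ∀ᵐ y ∂(P k m), y ∈ Set.Icc (0 : ℝ) 1

/-- Discrete payoff structure: average payoffs only take the values `Δ, 2Δ, 3Δ, … ≤ 1`. -/
def DiscretePayoffs {K M : ℕ} (μ : Fin K → Fin M → ℝ) (Δ : ℝ) : Prop :=
  ∀ k m, (∃ j : ℕ, 1 ≤ j ∧ μ k m = j * Δ) ∧ μ k m ≤ 1

/-- Latent content types: `ty m` is the content type of the message `m`. There are `L`
(nonempty) types, and in every context two messages have the same average payoff exactly if
they are of the same type. -/
def LatentTypes {K M L : ℕ} (μ : Fin K → Fin M → ℝ) (ty : Fin M → Fin L) : Prop :=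
  Function.Surjective ty ∧ ∀ k m₁ m₂, ty m₁ = ty m₂ ↔ μ k m₁ = μ k m₂

/-- The interaction of a server with the environment, one user per timeslot and no broadcasting.
`ℱ t` is the information at the end of slot `t` (it may contain additional randomness, for
breaking ties); `x t` is the context of the user of slot `t`, `a t` the message recommended
to that user, and `r t k m` the payoff that message `m` has in slot `t` in context `k`, of which
only `r t (x t) (a t)` is observed. Contexts are i.i.d. and uniform, payoffs are
i.i.d. over time with laws `P k m` and independent of the contexts, and the recommendation of a
slot is made from the past and from the current context. -/
structure Interaction {K M : ℕ} {Ω : Type*} [mΩ : MeasurableSpace Ω] (Pr : Measure Ω)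
    (P : Fin K → Fin M → Measure ℝ) (ℱ : Filtration ℕ mΩ)
    (x : ℕ → Ω → Fin K) (a : ℕ → Ω → Fin M) (r : ℕ → Fin K → Fin M → Ω → ℝ) : Prop where
  context_measurable : ∀ t, Measurable[ℱ (t + 1)] (x (t + 1))
  payoff_measurable : ∀ t k m, Measurable[ℱ (t + 1)] (r (t + 1) k m)
  context_uniform : ∀ t k, Pr.real {ω | x (t + 1) ω = k} = 1 / (K : ℝ)
  context_indep : ∀ t, Indep (MeasurableSpace.comap (x (t + 1)) ⊤) (ℱ t) Pr
  payoff_law : ∀ t k m, Pr.map (r (t + 1) k m) = P k m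
  payoff_indep : ∀ t k m, Indep (MeasurableSpace.comap (r (t + 1) k m) inferInstance)
    (ℱ t ⊔ MeasurableSpace.comap (x (t + 1)) ⊤) Pr
  action_measurable : ∀ t,
    Measurable[ℱ t ⊔ MeasurableSpace.comap (x (t + 1)) ⊤] (a (t + 1))

/-- The regret `R(T) = 𝔼 [∑_{t ≤ T} max_m μ(x_t, m) - ∑_{t ≤ T} r_t(x_t, a_t)]`. -/
def regret {K M : ℕ} {Ω : Type*} [MeasurableSpace Ω] (Pr : Measure Ω)
    (P : Fin K → Fin M → Measure ℝ)
    (x : ℕ → Ω → Fin K) (a : ℕ → Ω → Fin M) (r : ℕ → Fin K → Fin M → Ω → ℝ) (T : ℕ) : ℝ :=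
  ∫ ω, ((∑ t ∈ Finset.Icc 1 T, ⨆ m, meanPayoff P (x t ω) m)
    - ∑ t ∈ Finset.Icc 1 T, r t (x t ω) (a t ω) ω) ∂Pr

/-! ### Statistics of a sample path

Here `x`, `a`, `y` are the contexts, recommendations and observed payoffs on one path. All
statistics "at slot `t`" are those available when the recommendation of slot `t` is made, that
is, they run over the slots `1, …, t - 1`. -/

/-- The slots before `t` in which message `m` was recommended in context `k`. -/
def pastSlots {K M : ℕ} (x : ℕ → Fin K) (a : ℕ → Fin M) (t : ℕ) (k : Fin K) (m : Fin M) :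
    Finset ℕ :=
  (Finset.Ico 1 t).filter (fun u => x u = k ∧ a u = m)

/-- `Z(k, t, m)`: how often `m` has been recommended in context `k`. -/
def count {K M : ℕ} (x : ℕ → Fin K) (a : ℕ → Fin M) (t : ℕ) (k : Fin K) (m : Fin M) : ℕ :=
  (pastSlots x a t k m).card

/-- The average payoff realized so far by `m` in context `k` (`0` without samples). -/
def empMean {K M : ℕ} (x : ℕ → Fin K) (a : ℕ → Fin M) (y : ℕ → ℝ) (t : ℕ)
    (k : Fin K) (m : Fin M) : ℝ :=
  (∑ u ∈ pastSlots x a t k m, y u) / (count x a t k m : ℝ)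

/-- The exploration threshold `D(t) = (32 / δ²) log t`, where `δ` is the known lower bound of
the payoff resolution. -/
def threshold (δ : ℝ) (t : ℕ) : ℝ := 32 / δ ^ 2 * Real.log t

/-! ### Routine 1: allocating message pairs to contexts -/

/-- `S` is a family of `K` sets of `s` messages such that every pair of messages is contained in
one of the sets. -/
def CoversPairs {K M : ℕ} (S : Fin K → Finset (Fin M)) (s : ℕ) : Prop :=
  (∀ k, (S k).card = s) ∧ ∀ m₁ m₂, m₁ ≠ m₂ → ∃ k, m₁ ∈ S k ∧ m₂ ∈ S k

/-- `S` and `c` are a possible result of Routine 1: `S` is a covering design of `K` sets whose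
common size is as small as possible, the set `S k` is allocated to the context `k`, and each
pair of messages is assigned to one context whose set contains the pair. -/
def IsPairAllocation {K M : ℕ} (S : Fin K → Finset (Fin M)) (c : Sym2 (Fin M) → Fin K) : Prop :=
  (∃ s, CoversPairs S s ∧ ∀ (S' : Fin K → Finset (Fin M)) (s' : ℕ), CoversPairs S' s' → s ≤ s') ∧
  ∀ m₁ m₂, m₁ ≠ m₂ → m₁ ∈ S (c s(m₁, m₂)) ∧ m₂ ∈ S (c s(m₁, m₂))

/-! ### Routine 2: clustering into content types -/

/-- The estimated payoff difference of `m₁` and `m₂`, in the context their pair is assigned to. -/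
def pairDist {K M : ℕ} (c : Sym2 (Fin M) → Fin K) (x : ℕ → Fin K) (a : ℕ → Fin M) (y : ℕ → ℝ)
    (t : ℕ) (m₁ m₂ : Fin M) : ℝ :=
  |empMean x a y t (c s(m₁, m₂)) m₁ - empMean x a y t (c s(m₁, m₂)) m₂|

/-- Distance of two clusters: the maximal distance of two of their members. -/
def clusterDist {M : ℕ} (d : Fin M → Fin M → ℝ) (A B : Finset (Fin M)) : ℝ :=
  ⨆ p : {p : Fin M × Fin M // p.1 ∈ A ∧ p.2 ∈ B}, d p.1.1 p.1.2

/-- One step of the clustering: two different clusters whose distance is minimal, and smaller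
than `θ`, are merged. -/
def MergeStep {M : ℕ} (d : Fin M → Fin M → ℝ) (θ : ℝ) (𝒞 𝒞' : Finset (Finset (Fin M))) : Prop :=
  ∃ A ∈ 𝒞, ∃ B ∈ 𝒞, A ≠ B ∧
    (∀ A' ∈ 𝒞, ∀ B' ∈ 𝒞, A' ≠ B' → clusterDist d A B ≤ clusterDist d A' B') ∧
    clusterDist d A B < θ ∧
    𝒞' = insert (A ∪ B) ((𝒞.erase A).erase B)

/-- `𝒞` is a possible output of the clustering: it is obtained from the clustering into
singletons by merging as long as the minimal distance is smaller than `θ`. -/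
def IsClustering {M : ℕ} (d : Fin M → Fin M → ℝ) (θ : ℝ) (𝒞 : Finset (Finset (Fin M))) : Prop :=
  Relation.ReflTransGen (MergeStep d θ) (Finset.univ.image fun m => {m}) 𝒞 ∧
  ∀ A ∈ 𝒞, ∀ B ∈ 𝒞, A ≠ B → θ ≤ clusterDist d A B

/-- A rule that selects one representative of each content type. The set of representatives is a
function of the partition alone. -/
def IsRepresentativeRule {M : ℕ} (rep : Finset (Finset (Fin M)) → Finset (Fin M)) : Prop :=
  ∀ 𝒞 : Finpartition (Finset.univ : Finset (Fin M)), ∀ A ∈ 𝒞.parts, (rep 𝒞.parts ∩ A).card = 1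

/-! ### The algorithm -/

/-- Either recommend a message of `R` with fewer than `D(t)` recommendations in the current
context, any one of them, or, if there is none, a message that satisfies `otherwise`. -/
def ExploreOr {K M : ℕ} (δ : ℝ) (x : ℕ → Fin K) (a : ℕ → Fin M) (t : ℕ) (R : Finset (Fin M))
    (otherwise : Prop) : Prop :=
  (a t ∈ R ∧ (count x a t (x t) (a t) : ℝ) < threshold δ t) ∨
  ((∀ m ∈ R, threshold δ t ≤ (count x a t (x t) m : ℝ)) ∧ otherwise)

/-- The recommendation `a t` of slot `t` is one that the algorithm can make: Exploration 1 on the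
set `S k` of the current context `k = x t`; if nothing is left to explore there, clustering of
the messages and Exploration 2 on the representatives; if nothing is left to explore there
either, exploitation. -/
def AlgorithmStep {K M : ℕ} (δ : ℝ) (S : Fin K → Finset (Fin M)) (c : Sym2 (Fin M) → Fin K)
    (rep : Finset (Finset (Fin M)) → Finset (Fin M))
    (x : ℕ → Fin K) (a : ℕ → Fin M) (y : ℕ → ℝ) (t : ℕ) : Prop :=
  ExploreOr δ x a t (S (x t)) <|
    ∃ 𝒞, IsClustering (pairDist c x a y t) (δ / 2) 𝒞 ∧
      ExploreOr δ x a t (rep 𝒞)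
        (a t ∈ rep 𝒞 ∧ ∀ m ∈ rep 𝒞, empMean x a y t (x t) m ≤ empMean x a y t (x t) (a t))

end LatentBandit

end

/-!
A candidate of a context, that is, a message that can be explored there, is explored at most
`D(T) + 1` times in that context. So all exploration slots together cost
`O(K (σ + L) log T / δ²)`, where `σ` is the size of the allocated sets and `S k`, together with one
representative of each type, are the candidates of the context `k`.

The other slots cost nothing as long as all sufficiently sampled candidates are estimated up to
`δ / 4` and every context has arrived often in the second half of the past. Indeed, many arrivals of
the context `k` complete the first exploration of `S k` at an earlier slot, whose threshold was at
least `D(t) / 2`. All pair distances are then correct up to `δ / 2`, hence complete linkage recovers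
the types exactly, and a representative with maximal empirical average is optimal. After a burn-in
of `O(K σ log T / δ²)` slots, this fails in slot `t` with probability `O(K (σ + L) / t²)`, which is
summable: the estimates are controlled by the supermartingale
`exp (∑ (l (r u - μ) - l² / 8))` over the plays `u`, which spares a union bound over the number of
samples, and the arrivals by an exponential moment.

Finally `σ ≤ 8 M √(log (M K) / K) + 2`: for `g = ⌊√K⌋`, the unions of two out of `g` groups of
about `M / g` messages form a covering design.
-/

noncomputable section

namespace LatentBandit

open Finset
open scoped ENNReal

variable {K M : ℕ}

/-! ### Exploration slots -/

theorem card_filter_card_lt_le {α : Type*} [LinearOrder α] (s : Finset α) {D : ℝ} (hD : 0 ≤ D) :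
    (#{u ∈ s | (#{v ∈ s | v < u} : ℝ) < D} : ℝ) ≤ D + 1 := by
  set E := {u ∈ s | (#{v ∈ s | v < u} : ℝ) < D}
  rcases E.eq_empty_or_nonempty with h | h
  · rw [h, card_empty, Nat.cast_zero]
    linarith
  have hmax := mem_filter.1 (E.max'_mem h)
  have hsub : E.erase (E.max' h) ⊆ {v ∈ s | v < E.max' h} := fun u hu ↦
    mem_filter.2 ⟨(mem_filter.1 (mem_of_mem_erase hu)).1, E.lt_max'_of_mem_erase_max' h hu⟩
  have hcard : #E ≤ #{v ∈ s | v < E.max' h} + 1 := by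
    rw [← card_erase_add_one (E.max'_mem h)]
    exact Nat.succ_le_succ (card_le_card hsub)
  have hcard' : (#E : ℝ) ≤ #{v ∈ s | v < E.max' h} + 1 := mod_cast hcard
  linarith [hmax.2]

theorem count_mono (x : ℕ → Fin K) (a : ℕ → Fin M) {t u : ℕ} (h : t ≤ u) (k : Fin K)
    (m : Fin M) : count x a t k m ≤ count x a u k m :=
  card_le_card (filter_subset_filter _ (Ico_subset_Ico_right h))

/-- Slot `t` explores: its message belongs to the candidate set `R (x t)` of the current context
and has fewer than `D` samples there. -/
def Explores (x : ℕ → Fin K) (a : ℕ → Fin M) (D : ℝ) (R : Fin K → Finset (Fin M)) (t : ℕ) :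
    Prop :=
  a t ∈ R (x t) ∧ (count x a t (x t) (a t) : ℝ) < D

section

variable (x : ℕ → Fin K) (a : ℕ → Fin M) (N : ℕ) {D : ℝ} (hD : 0 ≤ D)
include hD

theorem card_count_lt_le (k : Fin K) (m : Fin M) :
    (#{t ∈ Icc 1 N | (x t = k ∧ a t = m) ∧ (count x a t k m : ℝ) < D} : ℝ) ≤ D + 1 := by
  refine le_trans (Nat.cast_le.2 (card_le_card fun t ht ↦ ?_))
    (card_filter_card_lt_le {t ∈ Icc 1 N | x t = k ∧ a t = m} hD)
  simp only [mem_filter, mem_Icc] at ht ⊢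
  have hpast : {v ∈ {v ∈ Icc 1 N | x v = k ∧ a v = m} | v < t} = pastSlots x a t k m := by
    ext v
    simp only [pastSlots, mem_filter, mem_Icc, mem_Ico]
    lia
  rw [hpast]
  exact ⟨⟨ht.1, ht.2.1⟩, ht.2.2⟩

open scoped Classical in
theorem card_explores_context_le (R : Fin K → Finset (Fin M)) (k : Fin K) :
    (#{t ∈ Icc 1 N | x t = k ∧ Explores x a D R t} : ℝ) ≤ #(R k) * (D + 1) := by
  have hmaps : Set.MapsTo a ({t ∈ Icc 1 N | x t = k ∧ Explores x a D R t} : Finset ℕ) (R k) := by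
    intro t ht
    obtain ⟨-, rfl, hR, -⟩ := mem_filter.1 ht
    exact hR
  rw [card_eq_sum_card_fiberwise hmaps, Nat.cast_sum, ← nsmul_eq_mul]
  refine sum_le_card_nsmul _ _ _ fun m _ ↦ le_trans (Nat.cast_le.2 (card_le_card fun t ht ↦ ?_))
    (card_count_lt_le x a N hD k m)
  simp only [mem_filter] at ht ⊢
  obtain ⟨⟨htN, rfl, -, hcount⟩, rfl⟩ := ht
  exact ⟨htN, ⟨rfl, rfl⟩, hcount⟩

open scoped Classical in
theorem card_explores_le (R : Fin K → Finset (Fin M)) :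
    (#{t ∈ Icc 1 N | Explores x a D R t} : ℝ) ≤ ∑ k, #(R k) * (D + 1) := by
  rw [card_eq_sum_card_fiberwise (f := x) (t := univ) fun _ _ ↦ mem_univ _, Nat.cast_sum]
  refine sum_le_sum fun k _ ↦ ?_
  rw [filter_filter]
  simpa only [and_comm] using card_explores_context_le x a N hD R k

end

/-! ### Complete linkage clustering -/

theorem exists_finpartition_parts_eq_insert_sup {α : Type*} [DistribLattice α] [OrderBot α]
    [DecidableEq α] {s A B : α} (P : Finpartition s) (hA : A ∈ P.parts) (hB : B ∈ P.parts)
    (hAB : A ≠ B) :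
    ∃ Q : Finpartition s, Q.parts = insert (A ⊔ B) ((P.parts.erase A).erase B) := by
  set E := (P.parts.erase A).erase B
  have hE : E ⊆ P.parts := (erase_subset _ _).trans (erase_subset _ _)
  have hparts : insert A (insert B E) = P.parts := by
    rw [insert_erase (mem_erase.2 ⟨hAB.symm, hB⟩), insert_erase hA]
  have hdisj : Disjoint (E.sup id) (A ⊔ B) :=
    disjoint_sup_right.2
      ⟨(P.supIndep hE hA fun h ↦ (mem_erase.1 (mem_erase.1 h).2).1 rfl).symm,
        (P.supIndep hE hB (notMem_erase _ _)).symm⟩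
  have hsup : E.sup id ⊔ (A ⊔ B) = s := by
    rw [← P.sup_parts, ← hparts, sup_insert, sup_insert, id_eq, id_eq]
    ac_rfl
  exact ⟨(P.ofSubset hE rfl).extend (mt (fun h ↦ (sup_eq_bot_iff.1 h).1) (P.ne_bot hA)) hdisj hsup,
    rfl⟩

section

variable {d : Fin M → Fin M → ℝ} {A B : Finset (Fin M)} {θ : ℝ}

theorem le_clusterDist (d : Fin M → Fin M → ℝ) {m₁ m₂ : Fin M} (h₁ : m₁ ∈ A) (h₂ : m₂ ∈ B) :
    d m₁ m₂ ≤ clusterDist d A B :=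
  le_ciSup (f := fun p : {p : Fin M × Fin M // p.1 ∈ A ∧ p.2 ∈ B} ↦ d p.1.1 p.1.2)
    (Set.finite_range _).bddAbove ⟨(m₁, m₂), h₁, h₂⟩

theorem clusterDist_lt (hA : A.Nonempty) (hB : B.Nonempty)
    (h : ∀ m₁ ∈ A, ∀ m₂ ∈ B, d m₁ m₂ < θ) : clusterDist d A B < θ := by
  obtain ⟨m₁, h₁⟩ := hA
  obtain ⟨m₂, h₂⟩ := hB
  have : Nonempty {p : Fin M × Fin M // p.1 ∈ A ∧ p.2 ∈ B} := ⟨⟨(m₁, m₂), h₁, h₂⟩⟩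
  obtain ⟨p, hp⟩ := exists_eq_ciSup_of_finite
    (f := fun p : {p : Fin M × Fin M // p.1 ∈ A ∧ p.2 ∈ B} ↦ d p.1.1 p.1.2)
  exact hp.symm.trans_lt (h _ p.2.1 _ p.2.2)

end

section

variable {ι : Type*} {ty : Fin M → ι}

open scoped Classical in
/-- The partition of the messages into content types, the intended output of the clustering. -/
def typePartition (ty : Fin M → ι) : Finpartition (univ : Finset (Fin M)) :=
  .ofSetoid (Setoid.ker ty)

theorem mem_part_typePartition {m m' : Fin M} :
    m' ∈ (typePartition ty).part m ↔ ty m = ty m' := by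
  classical
  exact Finpartition.mem_part_ofSetoid_iff_rel

theorem le_typePartition_iff {P : Finpartition (univ : Finset (Fin M))} :
    P ≤ typePartition ty ↔ ∀ A ∈ P.parts, ∀ m₁ ∈ A, ∀ m₂ ∈ A, ty m₁ = ty m₂ := by
  constructor
  · intro h A hA m₁ h₁ m₂ h₂
    obtain ⟨B, hB, hAB⟩ := h hA
    rw [← mem_part_typePartition, (typePartition ty).part_eq_of_mem hB (hAB h₁)]
    exact hAB h₂
  · intro h A hA
    obtain ⟨m, hm⟩ := P.nonempty_of_mem_parts hA
    exact ⟨_, (typePartition ty).part_mem.2 (mem_univ m),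
      fun m' hm' ↦ mem_part_typePartition.2 (h A hA m hm m' hm')⟩

section

variable {d : Fin M → Fin M → ℝ} {θ : ℝ} {P : Finpartition (univ : Finset (Fin M))}
  {𝒞 𝒞' : Finset (Finset (Fin M))}

theorem MergeStep.exists_finpartition_le (hd : ∀ m₁ m₂, m₁ ≠ m₂ → d m₁ m₂ < θ → ty m₁ = ty m₂)
    (hP : P ≤ typePartition ty) (h : MergeStep d θ P.parts 𝒞') :
    ∃ Q : Finpartition (univ : Finset (Fin M)), Q.parts = 𝒞' ∧ Q ≤ typePartition ty := by
  obtain ⟨A, hA, B, hB, hAB, -, hlt, rfl⟩ := h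
  obtain ⟨Q, hQ⟩ := exists_finpartition_parts_eq_insert_sup P hA hB hAB
  refine ⟨Q, hQ, le_typePartition_iff.2 fun X hX ↦ ?_⟩
  rw [le_typePartition_iff] at hP
  have hcross : ∀ m₁ ∈ A, ∀ m₂ ∈ B, ty m₁ = ty m₂ := fun m₁ h₁ m₂ h₂ ↦
    hd m₁ m₂ (disjoint_iff_ne.1 (P.disjoint hA hB hAB) m₁ h₁ m₂ h₂)
      ((le_clusterDist d h₁ h₂).trans_lt hlt)
  rw [hQ, mem_insert] at hX
  rcases hX with rfl | hX
  · intro m₁ h₁ m₂ h₂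
    rcases mem_union.1 h₁ with h₁ | h₁ <;> rcases mem_union.1 h₂ with h₂ | h₂
    · exact hP A hA m₁ h₁ m₂ h₂
    · exact hcross m₁ h₁ m₂ h₂
    · exact (hcross m₂ h₂ m₁ h₁).symm
    · exact hP B hB m₁ h₁ m₂ h₂
  · exact hP X (mem_of_mem_erase (mem_of_mem_erase hX))

theorem typePartition_le_of_le_clusterDist
    (hd : ∀ m₁ m₂, m₁ ≠ m₂ → ty m₁ = ty m₂ → d m₁ m₂ < θ) (hP : P ≤ typePartition ty)
    (hfinal : ∀ A ∈ P.parts, ∀ B ∈ P.parts, A ≠ B → θ ≤ clusterDist d A B) :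
    typePartition ty ≤ P := by
  intro C hC
  obtain ⟨m, hm⟩ := (typePartition ty).nonempty_of_mem_parts hC
  refine ⟨P.part m, P.part_mem.2 (mem_univ m), fun m' hm' ↦ ?_⟩
  have hmm' : ty m = ty m' := by
    rwa [← mem_part_typePartition, (typePartition ty).part_eq_of_mem hC hm]
  rw [le_typePartition_iff] at hP
  have hA := P.part_mem.2 (mem_univ m)
  have hB := P.part_mem.2 (mem_univ m')
  have hmA := P.mem_part (mem_univ m)
  have hmB := P.mem_part (mem_univ m')
  by_cases hAB : P.part m = P.part m'
  · rwa [hAB]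
  refine absurd (hfinal _ hA _ hB hAB) (not_le.2 (clusterDist_lt ⟨m, hmA⟩ ⟨m', hmB⟩ ?_))
  intro m₁ h₁ m₂ h₂
  refine hd m₁ m₂ (disjoint_iff_ne.1 (P.disjoint hA hB hAB) m₁ h₁ m₂ h₂) ?_
  rw [hP _ hA m₁ h₁ m hmA, hmm', hP _ hB m' hmB m₂ h₂]

theorem IsClustering.eq_parts_typePartition
    (hd : ∀ m₁ m₂, m₁ ≠ m₂ → (d m₁ m₂ < θ ↔ ty m₁ = ty m₂)) (h : IsClustering d θ 𝒞) :
    𝒞 = (typePartition ty).parts := by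
  obtain ⟨hsteps, hfinal⟩ := h
  have hinv : ∃ P : Finpartition (univ : Finset (Fin M)), P.parts = 𝒞 ∧ P ≤ typePartition ty := by
    clear hfinal
    induction hsteps with
    | refl => exact ⟨⊥, by rw [Finpartition.parts_bot, map_eq_image]; rfl, bot_le⟩
    | tail _ hstep ih =>
      obtain ⟨P, rfl, hP⟩ := ih
      exact hstep.exists_finpartition_le (fun m₁ m₂ hne ↦ (hd m₁ m₂ hne).1) hP
  obtain ⟨P, rfl, hP⟩ := hinv
  rw [hP.antisymm (typePartition_le_of_le_clusterDist (fun m₁ m₂ hne ↦ (hd m₁ m₂ hne).2) hP hfinal)]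

end

namespace IsRepresentativeRule

variable {rep : Finset (Finset (Fin M)) → Finset (Fin M)} (hrep : IsRepresentativeRule rep)
include hrep

theorem exists_mem_type_eq (ty : Fin M → ι) (m : Fin M) :
    ∃ m' ∈ rep (typePartition ty).parts, ty m' = ty m := by
  have h := hrep (typePartition ty) _ ((typePartition ty).part_mem.2 (mem_univ m))
  obtain ⟨m', hm'⟩ := card_pos.1 (h ▸ Nat.one_pos)
  exact ⟨m', (mem_inter.1 hm').1, (mem_part_typePartition.1 (mem_inter.1 hm').2).symm⟩

theorem card_le [Fintype ι] (ty : Fin M → ι) :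
    #(rep (typePartition ty).parts) ≤ Fintype.card ι := by
  refine card_le_card_of_injOn ty (fun _ _ ↦ mem_univ _) fun m₁ h₁ m₂ h₂ heq ↦ ?_
  have h := hrep (typePartition ty) _ ((typePartition ty).part_mem.2 (mem_univ m₁))
  exact card_le_one.1 h.le _ (mem_inter.2 ⟨h₁, mem_part_typePartition.2 rfl⟩)
    _ (mem_inter.2 ⟨h₂, mem_part_typePartition.2 heq⟩)

end IsRepresentativeRule

end

/-! ### Slots with reliable estimates -/

section

variable {δ : ℝ}

theorem threshold_nonneg (δ : ℝ) (t : ℕ) : 0 ≤ threshold δ t :=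
  mul_nonneg (by positivity) (Real.log_natCast_nonneg t)

theorem threshold_mono (δ : ℝ) {t u : ℕ} (ht : 1 ≤ t) (h : t ≤ u) :
    threshold δ t ≤ threshold δ u := by
  unfold threshold
  gcongr

theorem half_threshold_le (δ : ℝ) {t u : ℕ} (ht : 1 ≤ t) (h : t ≤ u ^ 2) :
    threshold δ t / 2 ≤ threshold δ u := by
  have hlog : Real.log t ≤ 2 * Real.log u := by
    have h' : (t : ℝ) ≤ (u : ℝ) ^ 2 := mod_cast h
    calc Real.log t ≤ Real.log ((u : ℝ) ^ 2) := by gcongr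
      _ = 2 * Real.log u := by rw [Real.log_pow, Nat.cast_ofNat]
  unfold threshold
  calc 32 / δ ^ 2 * Real.log t / 2 = 32 / δ ^ 2 * (Real.log t / 2) := by ring
    _ ≤ 32 / δ ^ 2 * Real.log u := by gcongr; linarith

/-- The types `ty` determine the average payoffs `μ`, and in every context different types have
averages that differ by at least `δ`. For payoffs on the lattice of multiples of some `Δ ≥ δ`, this
is all that the analysis retains of the lattice. -/
structure HasTypeGap {ι : Type*} (μ : Fin K → Fin M → ℝ) (ty : Fin M → ι) (δ : ℝ) : Prop where
  eq_of_type_eq : ∀ k m₁ m₂, ty m₁ = ty m₂ → μ k m₁ = μ k m₂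
  le_abs_sub : ∀ k m₁ m₂, ty m₁ ≠ ty m₂ → δ ≤ |μ k m₁ - μ k m₂|

theorem LatentTypes.hasTypeGap {L : ℕ} {μ : Fin K → Fin M → ℝ} {ty : Fin M → Fin L} {Δ : ℝ}
    (hty : LatentTypes μ ty) (hμ : DiscretePayoffs μ Δ) (hδ : 0 ≤ δ) (hΔ : δ ≤ Δ) :
    HasTypeGap μ ty δ := by
  refine ⟨fun k m₁ m₂ ↦ (hty.2 k m₁ m₂).1, fun k m₁ m₂ hne ↦ ?_⟩
  obtain ⟨⟨i, -, hi⟩, -⟩ := hμ k m₁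
  obtain ⟨⟨j, -, hj⟩, -⟩ := hμ k m₂
  have hij : i ≠ j := by
    rintro rfl
    exact hne ((hty.2 k m₁ m₂).2 (hi.trans hj.symm))
  have hone : (1 : ℝ) ≤ |(i : ℝ) - j| := by
    have : (1 : ℤ) ≤ |(i : ℤ) - j| := Int.one_le_abs (by lia)
    exact_mod_cast this
  calc δ ≤ 1 * Δ := by rwa [one_mul]
    _ ≤ |(i : ℝ) - j| * Δ := by gcongr; exact hδ.trans hΔ
    _ = |μ k m₁ - μ k m₂| := by rw [hi, hj, ← sub_mul, abs_mul, abs_of_nonneg (hδ.trans hΔ)]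

/-- The arrivals of context `k` in the second half of the slots before `t`. -/
def recentArrivals (x : ℕ → Fin K) (t : ℕ) (k : Fin K) : ℕ := #{u ∈ Ioo (t / 2) t | x u = k}

/-- The messages that can be explored in context `k` once the clustering finds the types. -/
def candidates {ι : Type*} (S : Fin K → Finset (Fin M))
    (rep : Finset (Finset (Fin M)) → Finset (Fin M)) (ty : Fin M → ι) (k : Fin K) :
    Finset (Fin M) :=
  S k ∪ rep (typePartition ty).parts

theorem IsRepresentativeRule.card_candidates_le {ι : Type*} [Fintype ι]
    {rep : Finset (Finset (Fin M)) → Finset (Fin M)} (hrep : IsRepresentativeRule rep)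
    (S : Fin K → Finset (Fin M)) (ty : Fin M → ι) (k : Fin K) :
    #(candidates S rep ty k) ≤ #(S k) + Fintype.card ι :=
  (card_union_le _ _).trans (Nat.add_le_add_left (hrep.card_le ty) _)

/-- In slot `t`, every sufficiently sampled candidate of `R` has an accurate empirical average, and
every context has arrived more than `b` times recently. -/
structure IsGoodSlot (δ : ℝ) (μ : Fin K → Fin M → ℝ) (R : Fin K → Finset (Fin M)) (b : ℝ)
    (x : ℕ → Fin K) (a : ℕ → Fin M) (y : ℕ → ℝ) (t : ℕ) : Prop where
  accurate : ∀ k, ∀ m ∈ R k, threshold δ t / 2 ≤ count x a t k m →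
    |empMean x a y t k m - μ k m| < δ / 4
  frequent : ∀ k, b < recentArrivals x t k

section

variable {S : Fin K → Finset (Fin M)} {c : Sym2 (Fin M) → Fin K}
  {rep : Finset (Finset (Fin M)) → Finset (Fin M)} {x : ℕ → Fin K} {a : ℕ → Fin M} {y : ℕ → ℝ}
  {t T : ℕ}

theorem recentArrivals_le_of_count_lt (halg : ∀ u, 1 ≤ u → AlgorithmStep δ S c rep x a y u)
    (ht : 4 ≤ t) (htT : t ≤ T) {k : Fin K} {m : Fin M} (hm : m ∈ S k)
    (hcount : (count x a t k m : ℝ) < threshold δ t / 2) :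
    (recentArrivals x t k : ℝ) ≤ #(S k) * (threshold δ T + 1) := by
  classical
  refine le_trans (Nat.cast_le.2 (card_le_card fun u hu ↦ ?_))
    (card_explores_context_le x a T (threshold_nonneg δ T) S k)
  simp only [mem_filter, mem_Ioo, mem_Icc] at hu ⊢
  obtain ⟨⟨htu, hut⟩, rfl⟩ := hu
  have hu : 1 ≤ u := by lia
  refine ⟨⟨hu, by lia⟩, rfl, ?_⟩
  rcases halg u hu with hexpl | ⟨hdone, -⟩
  · exact ⟨hexpl.1, hexpl.2.trans_le (threshold_mono δ hu (by lia))⟩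
  · have htu2 : t ≤ u ^ 2 := by
      have : t ≤ 2 * u := by lia
      nlinarith
    have hmono : (count x a u (x u) m : ℝ) ≤ count x a t (x u) m :=
      mod_cast count_mono x a hut.le _ _
    linarith [hdone m hm, half_threshold_le δ (by lia) htu2]

variable {ι : Type*} {μ : Fin K → Fin M → ℝ} {ty : Fin M → ι}

theorem pairDist_lt_iff_type_eq (hμ : HasTypeGap μ ty δ) {m₁ m₂ : Fin M}
    (h₁ : |empMean x a y t (c s(m₁, m₂)) m₁ - μ (c s(m₁, m₂)) m₁| < δ / 4)
    (h₂ : |empMean x a y t (c s(m₁, m₂)) m₂ - μ (c s(m₁, m₂)) m₂| < δ / 4) :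
    pairDist c x a y t m₁ m₂ < δ / 2 ↔ ty m₁ = ty m₂ := by
  unfold pairDist
  rw [abs_lt] at h₁ h₂ ⊢
  refine ⟨fun h ↦ ?_, fun h ↦ ?_⟩
  · by_contra hne
    rcases le_abs.1 (hμ.le_abs_sub (c s(m₁, m₂)) m₁ m₂ hne) with hgap | hgap <;> linarith
  · have heq := hμ.eq_of_type_eq (c s(m₁, m₂)) m₁ m₂ h
    constructor <;> linarith

theorem HasTypeGap.iSup_eq_of_empMean_le (hμ : HasTypeGap μ ty δ) {k : Fin K} {m : Fin M}
    {R : Finset (Fin M)} (hR : ∀ m', ∃ m'' ∈ R, ty m'' = ty m') (hm : m ∈ R)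
    (hacc : ∀ m' ∈ R, |empMean x a y t k m' - μ k m'| < δ / 4)
    (hmax : ∀ m' ∈ R, empMean x a y t k m' ≤ empMean x a y t k m) :
    ⨆ m', μ k m' = μ k m := by
  have : Nonempty (Fin M) := ⟨m⟩
  refine le_antisymm (ciSup_le fun m' ↦ ?_)
    (le_ciSup (f := fun m ↦ μ k m) (Set.finite_range _).bddAbove m)
  obtain ⟨m'', hm'', hty⟩ := hR m'
  rw [← hμ.eq_of_type_eq k m'' m' hty]
  by_contra! hlt
  have hgap := hμ.le_abs_sub k m'' m fun h ↦ hlt.ne' (hμ.eq_of_type_eq k m'' m h)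
  rw [abs_of_pos (sub_pos.2 hlt)] at hgap
  linarith [(abs_lt.1 (hacc m'' hm'')).1, (abs_lt.1 (hacc m hm)).2, hmax m'' hm'']

variable {b : ℝ} (hμ : HasTypeGap μ ty δ) (hS : IsPairAllocation S c)
  (hrep : IsRepresentativeRule rep) (halg : ∀ u, 1 ≤ u → AlgorithmStep δ S c rep x a y u)
  (hb : ∀ k, #(S k) * (threshold δ T + 1) ≤ b)
include hμ hS hrep halg hb

theorem IsGoodSlot.explores_or_iSup_eq (hgood : IsGoodSlot δ μ (candidates S rep ty) b x a y t)
    (ht : 4 ≤ t) (htT : t ≤ T) :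
    Explores x a (threshold δ T) (candidates S rep ty) t ∨ ⨆ m, μ (x t) m = μ (x t) (a t) := by
  have hthreshold := threshold_mono δ (by lia) htT
  have hsampled : ∀ k, ∀ m ∈ S k, threshold δ t / 2 ≤ count x a t k m := by
    intro k m hm
    by_contra! hlt
    linarith [recentArrivals_le_of_count_lt halg ht htT hm hlt, hb k, hgood.frequent k]
  have haccS : ∀ k, ∀ m ∈ S k, |empMean x a y t k m - μ k m| < δ / 4 := fun k m hm ↦
    hgood.accurate k m (mem_union_left _ hm) (hsampled k m hm)
  rcases halg t (by lia) with hexpl | ⟨-, 𝒞, h𝒞, hclustered⟩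
  · exact Or.inl ⟨mem_union_left _ hexpl.1, hexpl.2.trans_le hthreshold⟩
  have hpair : ∀ m₁ m₂, m₁ ≠ m₂ → (pairDist c x a y t m₁ m₂ < δ / 2 ↔ ty m₁ = ty m₂) :=
    fun m₁ m₂ hne ↦ pairDist_lt_iff_type_eq hμ (haccS _ _ (hS.2 m₁ m₂ hne).1)
      (haccS _ _ (hS.2 m₁ m₂ hne).2)
  rw [h𝒞.eq_parts_typePartition hpair] at hclustered
  rcases hclustered with hexpl | ⟨hdone, hmem, hmax⟩
  · exact Or.inl ⟨mem_union_right _ hexpl.1, hexpl.2.trans_le hthreshold⟩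
  · refine Or.inr (hμ.iSup_eq_of_empMean_le (hrep.exists_mem_type_eq ty) hmem (fun m hm ↦ ?_) hmax)
    exact hgood.accurate _ m (mem_union_right _ hm)
      (by linarith [hdone m hm, threshold_nonneg δ t])

open scoped Classical in
theorem gap_le_sum_ite (hIcc : ∀ k m, μ k m ∈ Set.Icc 0 1) {τ : ℕ} (hτ : 3 ≤ τ) (htT : t ≤ T) :
    (⨆ m, μ (x t) m) - μ (x t) (a t) ≤
      (if t ≤ τ then 1 else 0) +
        (if Explores x a (threshold δ T) (candidates S rep ty) t then 1 else 0) +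
        (if τ < t ∧ ¬IsGoodSlot δ μ (candidates S rep ty) b x a y t then 1 else 0) := by
  have : Nonempty (Fin M) := ⟨a t⟩
  have hle : ⨆ m, μ (x t) m ≤ 1 := ciSup_le fun m ↦ (hIcc _ m).2
  have hnonneg := (hIcc (x t) (a t)).1
  rcases le_or_gt t τ with hearly | hlate
  · rw [if_pos hearly]
    split_ifs <;> linarith
  by_cases hgood : IsGoodSlot δ μ (candidates S rep ty) b x a y t
  · rcases hgood.explores_or_iSup_eq hμ hS hrep halg hb (by lia) htT with hexpl | heq
    · rw [if_pos hexpl]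
      split_ifs <;> linarith
    · rw [heq, sub_self]
      split_ifs <;> norm_num
  · rw [if_pos (And.intro hlate hgood)]
    split_ifs <;> linarith

open scoped Classical in
theorem sum_gap_le (hIcc : ∀ k m, μ k m ∈ Set.Icc 0 1) {τ : ℕ} (hτ : 3 ≤ τ) :
    ∑ t ∈ Icc 1 T, ((⨆ m, μ (x t) m) - μ (x t) (a t)) ≤
      τ + ∑ k, #(candidates S rep ty k) * (threshold δ T + 1) +
        #{t ∈ Ioc τ T | ¬IsGoodSlot δ μ (candidates S rep ty) b x a y t} := by
  refine (sum_le_sum fun t ht ↦ gap_le_sum_ite hμ hS hrep halg hb hIcc hτ (mem_Icc.1 ht).2).trans ?_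
  rw [sum_add_distrib, sum_add_distrib, sum_boole, sum_boole, sum_boole]
  have hearly : (#{t ∈ Icc 1 T | t ≤ τ} : ℝ) ≤ τ := by
    have hsub : {t ∈ Icc 1 T | t ≤ τ} ⊆ Icc 1 τ := fun t ht ↦ by
      simp only [mem_filter, mem_Icc] at ht ⊢
      exact ⟨ht.1.1, ht.2⟩
    exact_mod_cast (card_le_card hsub).trans_eq (Nat.card_Icc 1 τ)
  have hbad : {t ∈ Icc 1 T | τ < t ∧ ¬IsGoodSlot δ μ (candidates S rep ty) b x a y t} =
      {t ∈ Ioc τ T | ¬IsGoodSlot δ μ (candidates S rep ty) b x a y t} := by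
    ext t
    simp only [mem_filter, mem_Icc, mem_Ioc]
    lia
  rw [hbad]
  exact add_le_add_left
    (add_le_add hearly (card_explores_le x a T (threshold_nonneg δ T) _)) _

end

end

/-! ### Exponential products and random selection -/

section

variable {Ω : Type*} {m₁ m₂ mΩ : MeasurableSpace Ω} {Pr : Measure Ω}

theorem lintegral_mul_ite_le {A : Set Ω} [DecidablePred (· ∈ A)] (hm₁ : m₁ ≤ mΩ)
    (hm₂ : m₂ ≤ mΩ) (hindep : Indep m₁ m₂ Pr) (hA : MeasurableSet[m₂] A) {E G : Ω → ℝ≥0∞}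
    (hE : Measurable[m₁] E) (hG : Measurable[m₂] G) (hE1 : ∫⁻ ω, E ω ∂Pr ≤ 1) :
    ∫⁻ ω, G ω * (if ω ∈ A then E ω else 1) ∂Pr ≤ ∫⁻ ω, G ω ∂Pr := by
  have hsplit : ∀ ω, G ω * (if ω ∈ A then E ω else 1) =
      Aᶜ.indicator G ω + E ω * A.indicator G ω := by
    intro ω
    by_cases hω : ω ∈ A <;> simp [hω, mul_comm]
  have hGc : Measurable (Aᶜ.indicator G) := (hG.mono hm₂ le_rfl).indicator (hm₂ _ hA).compl
  simp_rw [hsplit]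
  rw [lintegral_add_left hGc,
    lintegral_mul_eq_lintegral_mul_lintegral_of_independent_measurableSpace hm₁ hm₂ hindep hE
      (hG.indicator hA)]
  calc ∫⁻ ω, Aᶜ.indicator G ω ∂Pr + (∫⁻ ω, E ω ∂Pr) * ∫⁻ ω, A.indicator G ω ∂Pr
      ≤ ∫⁻ ω, Aᶜ.indicator G ω ∂Pr + 1 * ∫⁻ ω, A.indicator G ω ∂Pr := by gcongr
    _ = ∫⁻ ω, G ω ∂Pr := by
      rw [one_mul, ← lintegral_add_left hGc]
      exact lintegral_congr fun ω ↦ congrFun (Set.indicator_compl_add_self A G) ω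

theorem setIntegral_eq_setIntegral_integral_of_indep [IsProbabilityMeasure Pr] {A : Set Ω}
    (hm₁ : m₁ ≤ mΩ) (hm₂ : m₂ ≤ mΩ) (hindep : Indep m₁ m₂ Pr) {f : Ω → ℝ}
    (hf : Measurable[m₁] f) (hfi : Integrable f Pr) (hA : MeasurableSet[m₂] A) :
    ∫ ω in A, f ω ∂Pr = ∫ _ in A, (∫ ω', f ω' ∂Pr) ∂Pr := by
  rw [← setIntegral_condExp hm₂ hfi hA]
  exact integral_congr_ae
    (ae_restrict_of_ae (condExp_indep_eq hm₁ hm₂ hf.stronglyMeasurable hindep))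

section

variable {ι : Type*} {J : Ω → ι} {f : ι → Ω → ℝ}

open scoped Classical in
theorem select_eq_sum_indicator [Fintype ι] (J : Ω → ι) (f : ι → Ω → ℝ) :
    (fun ω ↦ f (J ω) ω) = fun ω ↦ ∑ i, (J ⁻¹' {i}).indicator (f i) ω := by
  ext ω
  rw [sum_eq_single_of_mem (J ω) (mem_univ _) fun i _ hi ↦
    Set.indicator_of_notMem (s := J ⁻¹' {i}) (fun h ↦ hi h.symm) (f i)]
  exact (Set.indicator_of_mem (s := J ⁻¹' {J ω}) rfl (f (J ω))).symm

theorem integrable_select [Finite ι] (hJ : ∀ i, MeasurableSet (J ⁻¹' {i}))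
    (hf : ∀ i, Integrable (f i) Pr) :
    Integrable (fun ω ↦ f (J ω) ω) Pr := by
  cases nonempty_fintype ι
  rw [select_eq_sum_indicator]
  exact integrable_finsetSum _ fun i _ ↦ (hf i).indicator (hJ i)

theorem integral_select_eq_of_indep [Finite ι] [IsProbabilityMeasure Pr] (hm₂ : m₂ ≤ mΩ)
    (hJ : ∀ i, MeasurableSet[m₂] (J ⁻¹' {i})) (hfm : ∀ i, Measurable (f i))
    (hf : ∀ i, Integrable (f i) Pr)
    (hindep : ∀ i, Indep (MeasurableSpace.comap (f i) inferInstance) m₂ Pr) :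
    ∫ ω, f (J ω) ω ∂Pr = ∫ ω, (∫ ω', f (J ω) ω' ∂Pr) ∂Pr := by
  cases nonempty_fintype ι
  have hJ' : ∀ i, MeasurableSet (J ⁻¹' {i}) := fun i ↦ hm₂ _ (hJ i)
  rw [select_eq_sum_indicator, select_eq_sum_indicator J fun i _ ↦ ∫ ω', f i ω' ∂Pr,
    integral_finsetSum _ fun i _ ↦ (hf i).indicator (hJ' i),
    integral_finsetSum _ fun i _ ↦ (integrable_const _).indicator (hJ' i)]
  refine sum_congr rfl fun i _ ↦ ?_
  rw [integral_indicator (hJ' i), integral_indicator (hJ' i)]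
  exact setIntegral_eq_setIntegral_integral_of_indep (hfm i).comap_le hm₂ (hindep i)
    (comap_measurable _) (hf i) (hJ i)

end

variable [IsProbabilityMeasure Pr]

section

variable {ℱ : Filtration ℕ mΩ} {F : ℕ → Ω → ℝ≥0∞} {c : ℝ≥0∞}
  (hF : ∀ t, Measurable[ℱ (t + 1)] (F (t + 1)))
include hF

theorem measurable_prod_Ioc (b n : ℕ) :
    Measurable[ℱ (b + n)] fun ω ↦ ∏ u ∈ Ioc b (b + n), F u ω := by
  refine Finset.measurable_fun_prod _ fun u hu ↦ ?_
  obtain ⟨v, rfl⟩ := Nat.exists_eq_succ_of_ne_zero (Nat.ne_zero_of_lt (mem_Ioc.1 hu).1)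
  exact (hF v).mono (ℱ.mono (mem_Ioc.1 hu).2) le_rfl

theorem lintegral_prod_Ioc_le
    (hstep : ∀ t G, Measurable[ℱ t] G → ∫⁻ ω, G ω * F (t + 1) ω ∂Pr ≤ c * ∫⁻ ω, G ω ∂Pr)
    (b n : ℕ) : ∫⁻ ω, ∏ u ∈ Ioc b (b + n), F u ω ∂Pr ≤ c ^ n := by
  induction n with
  | zero => simp
  | succ n ih =>
    calc ∫⁻ ω, ∏ u ∈ Ioc b (b + (n + 1)), F u ω ∂Pr
        = ∫⁻ ω, (∏ u ∈ Ioc b (b + n), F u ω) * F (b + n + 1) ω ∂Pr := by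
          simp_rw [← add_assoc, prod_Ioc_succ_top (Nat.le_add_right b n)]
      _ ≤ c * ∫⁻ ω, ∏ u ∈ Ioc b (b + n), F u ω ∂Pr := hstep _ _ (measurable_prod_Ioc hF b n)
      _ ≤ c ^ (n + 1) := by rw [pow_succ']; gcongr

theorem measure_exp_le_prod_Ioc_le {κ : ℝ}
    (hstep : ∀ t G, Measurable[ℱ t] G →
      ∫⁻ ω, G ω * F (t + 1) ω ∂Pr ≤ ENNReal.ofReal (Real.exp κ) * ∫⁻ ω, G ω ∂Pr)
    (b n : ℕ) (s : ℝ) :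
    Pr {ω | ENNReal.ofReal (Real.exp s) ≤ ∏ u ∈ Ioc b (b + n), F u ω} ≤
      ENNReal.ofReal (Real.exp (n * κ - s)) :=
  calc Pr {ω | ENNReal.ofReal (Real.exp s) ≤ ∏ u ∈ Ioc b (b + n), F u ω}
      ≤ (∫⁻ ω, ∏ u ∈ Ioc b (b + n), F u ω ∂Pr) / ENNReal.ofReal (Real.exp s) :=
        meas_ge_le_lintegral_div ((measurable_prod_Ioc hF b n).mono (ℱ.le _) le_rfl).aemeasurable
          (by simpa using Real.exp_pos s) ENNReal.ofReal_ne_top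
    _ ≤ ENNReal.ofReal (Real.exp κ) ^ n / ENNReal.ofReal (Real.exp s) := by
        gcongr
        exact lintegral_prod_Ioc_le hF hstep b n
    _ = ENNReal.ofReal (Real.exp (n * κ - s)) := by
        rw [← ENNReal.ofReal_pow (Real.exp_pos _).le,
          ← ENNReal.ofReal_div_of_pos (Real.exp_pos s), ← Real.exp_nat_mul, ← Real.exp_sub]

end

theorem lintegral_exp_mul_sub_integral_le_one {X : Ω → ℝ} (hX : AEMeasurable X Pr)
    (hIcc : ∀ᵐ ω ∂Pr, X ω ∈ Set.Icc (0 : ℝ) 1) (l : ℝ) :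
    ∫⁻ ω, ENNReal.ofReal (Real.exp (l * (X ω - ∫ ω', X ω' ∂Pr) - l ^ 2 / 8)) ∂Pr ≤ 1 := by
  have hsub := hasSubgaussianMGF_of_mem_Icc hX hIcc
  simp_rw [Real.exp_sub]
  rw [← ofReal_integral_eq_lintegral_ofReal ((hsub.integrable_exp_mul l).div_const _)
    (ae_of_all _ fun _ ↦ by positivity), ENNReal.ofReal_le_one, integral_div,
    div_le_one (Real.exp_pos _)]
  refine (hsub.mgf_le l).trans_eq ?_
  congr 1
  simp only [sub_zero, nnnorm_one, one_div, inv_pow, NNReal.coe_inv, NNReal.coe_pow,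
    NNReal.coe_ofNat]
  ring

theorem lintegral_ite_exp_neg_one_le {A : Set Ω} [DecidablePred (· ∈ A)] (hA : MeasurableSet A) :
    ∫⁻ ω, (if ω ∈ A then ENNReal.ofReal (Real.exp (-1)) else 1) ∂Pr ≤
      ENNReal.ofReal (Real.exp (-(Pr.real A / 2))) := by
  have hind : Integrable (A.indicator fun _ ↦ 1 - Real.exp (-1)) Pr :=
    (integrable_const _).indicator hA
  have hweight : ∀ ω, (if ω ∈ A then ENNReal.ofReal (Real.exp (-1)) else 1) =
      ENNReal.ofReal (1 - A.indicator (fun _ ↦ 1 - Real.exp (-1)) ω) := by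
    intro ω
    by_cases hω : ω ∈ A <;> simp [hω]
  have hnonneg : ∀ ω, 0 ≤ 1 - A.indicator (fun _ ↦ 1 - Real.exp (-1)) ω := by
    intro ω
    by_cases hω : ω ∈ A <;> simp [hω, Real.exp_nonneg]
  simp_rw [hweight]
  rw [← ofReal_integral_eq_lintegral_ofReal (f := fun ω ↦ 1 - A.indicator _ ω)
    ((integrable_const 1).sub hind) (ae_of_all _ hnonneg)]
  refine ENNReal.ofReal_le_ofReal ?_
  calc ∫ ω, (1 - A.indicator (fun _ ↦ 1 - Real.exp (-1)) ω) ∂Pr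
      = 1 - Pr.real A * (1 - Real.exp (-1)) := by
        rw [integral_sub (integrable_const _) hind, integral_indicator_const _ hA]
        simp
    _ ≤ 1 - Pr.real A / 2 := by
        nlinarith [Real.exp_neg_one_lt_d9, measureReal_nonneg (μ := Pr) (s := A)]
    _ ≤ Real.exp (-(Pr.real A / 2)) := by linarith [Real.add_one_le_exp (-(Pr.real A / 2))]

theorem integral_le_add_sum_measureReal {ι : Type*} {f : Ω → ℝ} (hf : Integrable f Pr) {c : ℝ}
    (s : Finset ι) (B : ι → Set Ω) [∀ ω, DecidablePred (ω ∈ B ·)]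
    (hle : ∀ᵐ ω ∂Pr, f ω ≤ c + #{i ∈ s | ω ∈ B i}) :
    ∫ ω, f ω ∂Pr ≤ c + ∑ i ∈ s, Pr.real (B i) := by
  set I : ι → Ω → ℝ := fun i ↦ (toMeasurable Pr (B i)).indicator fun _ ↦ (1 : ℝ)
  have hI : ∀ i, Integrable (I i) Pr := fun i ↦
    (integrable_const _).indicator (measurableSet_toMeasurable Pr (B i))
  have hsum : Integrable (fun ω ↦ ∑ i ∈ s, I i ω) Pr := integrable_finsetSum _ fun i _ ↦ hI i
  calc ∫ ω, f ω ∂Pr ≤ ∫ ω, (c + ∑ i ∈ s, I i ω) ∂Pr := by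
        refine integral_mono_ae hf ((integrable_const c).add hsum) ?_
        filter_upwards [hle] with ω hω
        refine hω.trans (add_le_add_right ?_ c)
        rw [← sum_boole]
        refine sum_le_sum fun i _ ↦ ?_
        split_ifs with hi
        · exact (Set.indicator_of_mem (subset_toMeasurable Pr (B i) hi) fun _ ↦ (1 : ℝ)).ge
        · exact Set.indicator_nonneg (fun _ _ ↦ zero_le_one) ω
    _ = c + ∑ i ∈ s, Pr.real (B i) := by
        rw [integral_add (integrable_const c) hsum, integral_finsetSum _ fun i _ ↦ hI i,
          integral_const, probReal_univ, one_smul]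
        congr 1
        refine sum_congr rfl fun i _ ↦ ?_
        rw [integral_indicator_const _ (measurableSet_toMeasurable Pr (B i)), smul_eq_mul, mul_one,
          measureReal_def, measure_toMeasurable, measureReal_def]

end

/-! ### Deviations and arrivals -/

theorem sum_pastSlots_sub (x : ℕ → Fin K) (a : ℕ → Fin M) (y : ℕ → ℝ) (t : ℕ) (k : Fin K)
    (m : Fin M) (c : ℝ) :
    ∑ u ∈ pastSlots x a t k m, (y u - c) = count x a t k m * (empMean x a y t k m - c) := by
  rw [sum_sub_distrib, sum_const, nsmul_eq_mul, mul_sub]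
  congr 1
  unfold empMean
  rcases eq_or_ne (count x a t k m) 0 with hzero | hpos
  · rw [card_eq_zero.1 hzero, sum_empty, zero_div, mul_zero]
  · rw [mul_div_cancel₀ _ (Nat.cast_ne_zero.2 hpos)]

section

variable {Ω : Type*}

/-- The payoff that the server observes in slot `u`, on the path `ω`. -/
def observedPayoff (x : ℕ → Ω → Fin K) (a : ℕ → Ω → Fin M) (r : ℕ → Fin K → Fin M → Ω → ℝ)
    (ω : Ω) (u : ℕ) : ℝ :=
  r u (x u ω) (a u ω) ω

/-- The factor of slot `t` in the exponential supermartingale that controls the empirical average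
of `m` in context `k`. The compensator `l ^ 2 / 8` is the one of Hoeffding's lemma. -/
def payoffWeight (P : Fin K → Fin M → Measure ℝ) (x : ℕ → Ω → Fin K) (a : ℕ → Ω → Fin M)
    (r : ℕ → Fin K → Fin M → Ω → ℝ) (k : Fin K) (m : Fin M) (l : ℝ) (t : ℕ) (ω : Ω) : ℝ≥0∞ :=
  if x t ω = k ∧ a t ω = m then
    ENNReal.ofReal (Real.exp (l * (r t k m ω - meanPayoff P k m) - l ^ 2 / 8))
  else 1

/-- The factor of slot `t` in the exponential moment that bounds the number of arrivals of
context `k` from below. -/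
def arrivalWeight (x : ℕ → Ω → Fin K) (k : Fin K) (t : ℕ) (ω : Ω) : ℝ≥0∞ :=
  if x t ω = k then ENNReal.ofReal (Real.exp (-1)) else 1

theorem prod_payoffWeight (P : Fin K → Fin M → Measure ℝ) (x : ℕ → Ω → Fin K)
    (a : ℕ → Ω → Fin M) (r : ℕ → Fin K → Fin M → Ω → ℝ) (k : Fin K) (m : Fin M) (l : ℝ) (n : ℕ)
    (ω : Ω) :
    ∏ u ∈ Ioc 0 n, payoffWeight P x a r k m l u ω =
      ENNReal.ofReal (Real.exp (count (x · ω) (a · ω) (n + 1) k m *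
        (l * (empMean (x · ω) (a · ω) (observedPayoff x a r ω) (n + 1) k m - meanPayoff P k m)
          - l ^ 2 / 8))) := by
  have hslots : {u ∈ Ioc 0 n | x u ω = k ∧ a u ω = m} = pastSlots (x · ω) (a · ω) (n + 1) k m := by
    ext u
    simp only [pastSlots, mem_filter, mem_Ioc, mem_Ico, Nat.lt_succ_iff, Nat.pos_iff_ne_zero,
      Nat.one_le_iff_ne_zero]
  have hobserved : ∀ u ∈ pastSlots (x · ω) (a · ω) (n + 1) k m,
      r u k m ω = observedPayoff x a r ω u := by
    intro u hu
    obtain ⟨-, rfl, rfl⟩ := mem_filter.1 hu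
    rfl
  unfold payoffWeight
  rw [prod_ite, prod_const_one, mul_one, hslots,
    ← ENNReal.ofReal_prod_of_nonneg fun _ _ ↦ (Real.exp_pos _).le, ← Real.exp_sum,
    sum_sub_distrib, ← mul_sum, sum_congr rfl fun u hu ↦ congrArg (· - _) (hobserved u hu),
    sum_pastSlots_sub, sum_const, nsmul_eq_mul]
  congr 2
  unfold count
  ring

theorem prod_arrivalWeight (x : ℕ → Ω → Fin K) (k : Fin K) (s : Finset ℕ) (ω : Ω) :
    ∏ u ∈ s, arrivalWeight x k u ω = ENNReal.ofReal (Real.exp (-#{u ∈ s | x u ω = k})) := by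
  unfold arrivalWeight
  rw [prod_ite, prod_const_one, mul_one, prod_const, ← ENNReal.ofReal_pow (Real.exp_pos _).le,
    ← Real.exp_nat_mul, mul_neg_one]

namespace Interaction

variable {mΩ : MeasurableSpace Ω} {Pr : Measure Ω} {P : Fin K → Fin M → Measure ℝ}
  {ℱ : Filtration ℕ mΩ} {x : ℕ → Ω → Fin K} {a : ℕ → Ω → Fin M}
  {r : ℕ → Fin K → Fin M → Ω → ℝ}

/-- What the server knows when it makes the recommendation of slot `t + 1`. -/
abbrev information (ℱ : Filtration ℕ mΩ) (x : ℕ → Ω → Fin K) (t : ℕ) : MeasurableSpace Ω :=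
  ℱ t ⊔ MeasurableSpace.comap (x (t + 1)) ⊤

theorem information_le (h : Interaction Pr P ℱ x a r) (t : ℕ) :
    information ℱ x t ≤ ℱ (t + 1) :=
  sup_le (ℱ.mono t.le_succ) (h.context_measurable t).comap_le

theorem measurableSet_play (h : Interaction Pr P ℱ x a r) (t : ℕ) (k : Fin K) (m : Fin M) :
    MeasurableSet[information ℱ x t] {ω | x (t + 1) ω = k ∧ a (t + 1) ω = m} :=
  MeasurableSet.inter (le_sup_right (a := ℱ t) _ ⟨{k}, trivial, rfl⟩)
    (h.action_measurable t (measurableSet_singleton m))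

theorem measurable_payoff (h : Interaction Pr P ℱ x a r) (t : ℕ) (k : Fin K) (m : Fin M) :
    Measurable (r (t + 1) k m) :=
  (h.payoff_measurable t k m).mono (ℱ.le _) le_rfl

theorem payoff_mem_Icc (h : Interaction Pr P ℱ x a r) (hP : IsPayoffLaw P) (t : ℕ) (k : Fin K)
    (m : Fin M) : ∀ᵐ ω ∂Pr, r (t + 1) k m ω ∈ Set.Icc (0 : ℝ) 1 := by
  have hlaw := (hP k m).2
  rw [← h.payoff_law t k m] at hlaw
  exact ae_of_ae_map (h.measurable_payoff t k m).aemeasurable hlaw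

theorem integral_payoff (h : Interaction Pr P ℱ x a r) (t : ℕ) (k : Fin K) (m : Fin M) :
    ∫ ω, r (t + 1) k m ω ∂Pr = meanPayoff P k m := by
  rw [meanPayoff, ← h.payoff_law t k m,
    integral_map (h.measurable_payoff t k m).aemeasurable measurable_id'.aestronglyMeasurable]

theorem measurable_payoffWeight (h : Interaction Pr P ℱ x a r) (k : Fin K) (m : Fin M) (l : ℝ)
    (t : ℕ) : Measurable[ℱ (t + 1)] (payoffWeight P x a r k m l (t + 1)) := by
  have hr := h.payoff_measurable t k m
  exact Measurable.ite (h.information_le t _ (h.measurableSet_play t k m))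
    (((hr.sub_const _).const_mul l).sub_const _).exp.ennreal_ofReal measurable_const

theorem measurable_arrivalWeight (x : ℕ → Ω → Fin K) (k : Fin K) (t : ℕ) :
    Measurable[MeasurableSpace.comap (x (t + 1)) ⊤] (arrivalWeight x k (t + 1)) :=
  Measurable.ite ⟨{k}, trivial, rfl⟩ measurable_const measurable_const

theorem integrable_select_play (h : Interaction Pr P ℱ x a r) (t : ℕ)
    {f : Fin K → Fin M → Ω → ℝ} (hf : ∀ k m, Integrable (f k m) Pr) :
    Integrable (fun ω ↦ f (x (t + 1) ω) (a (t + 1) ω) ω) Pr :=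
  integrable_select (J := fun ω ↦ (x (t + 1) ω, a (t + 1) ω)) (f := fun p ↦ f p.1 p.2)
    (fun p ↦ ℱ.le (t + 1) _ (h.information_le t _
      (by simpa only [Set.preimage, Set.mem_singleton_iff, Prod.ext_iff] using
        h.measurableSet_play t p.1 p.2)))
    fun p ↦ hf p.1 p.2

variable [IsProbabilityMeasure Pr]

theorem integrable_payoff (h : Interaction Pr P ℱ x a r) (hP : IsPayoffLaw P) (t : ℕ) (k : Fin K)
    (m : Fin M) : Integrable (r (t + 1) k m) Pr :=
  Integrable.of_mem_Icc 0 1 (h.measurable_payoff t k m).aemeasurable (h.payoff_mem_Icc hP t k m)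

theorem lintegral_mul_payoffWeight_le (h : Interaction Pr P ℱ x a r) (hP : IsPayoffLaw P)
    (k : Fin K) (m : Fin M) (l : ℝ) (t : ℕ) {G : Ω → ℝ≥0∞} (hG : Measurable[ℱ t] G) :
    ∫⁻ ω, G ω * payoffWeight P x a r k m l (t + 1) ω ∂Pr ≤ ∫⁻ ω, G ω ∂Pr := by
  have hr := h.measurable_payoff t k m
  have hr' : Measurable[MeasurableSpace.comap (r (t + 1) k m) inferInstance] (r (t + 1) k m) :=
    comap_measurable _
  refine lintegral_mul_ite_le hr.comap_le ((h.information_le t).trans (ℱ.le _))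
    (h.payoff_indep t k m) (h.measurableSet_play t k m)
    (((hr'.sub_const _).const_mul l).sub_const _).exp.ennreal_ofReal
    (hG.mono le_sup_left le_rfl) ?_
  rw [← h.integral_payoff t k m]
  exact lintegral_exp_mul_sub_integral_le_one hr.aemeasurable (h.payoff_mem_Icc hP t k m) l

theorem lintegral_mul_arrivalWeight_le (h : Interaction Pr P ℱ x a r) (k : Fin K) (t : ℕ)
    {G : Ω → ℝ≥0∞} (hG : Measurable[ℱ t] G) :
    ∫⁻ ω, G ω * arrivalWeight x k (t + 1) ω ∂Pr ≤
      ENNReal.ofReal (Real.exp (-(1 / (2 * K)))) * ∫⁻ ω, G ω ∂Pr := by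
  have hcontext := (h.context_measurable t).comap_le.trans (ℱ.le _)
  have harrival : ∫⁻ ω, arrivalWeight x k (t + 1) ω ∂Pr ≤
      ENNReal.ofReal (Real.exp (-(1 / (2 * K)))) := by
    have hk : MeasurableSet {ω | x (t + 1) ω = k} := hcontext _ ⟨{k}, trivial, rfl⟩
    refine (lintegral_ite_exp_neg_one_le hk).trans_eq ?_
    rw [h.context_uniform t k, div_div, mul_comm]
  rw [lintegral_mul_eq_lintegral_mul_lintegral_of_independent_measurableSpace (ℱ.le t) hcontext
    (h.context_indep t).symm hG (measurable_arrivalWeight x k t), mul_comm]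
  gcongr

theorem measure_signed_deviation_le (h : Interaction Pr P ℱ x a r) (hP : IsPayoffLaw P)
    (k : Fin K) (m : Fin M) {t : ℕ} (ht : 1 ≤ t) {ε σ : ℝ} (hε : 0 ≤ ε) (hσ : σ ^ 2 = 1) (n₀ : ℝ) :
    Pr {ω | n₀ ≤ count (x · ω) (a · ω) t k m ∧ ε ≤ σ *
        (empMean (x · ω) (a · ω) (observedPayoff x a r ω) t k m - meanPayoff P k m)} ≤
      ENNReal.ofReal (Real.exp (-(2 * ε ^ 2 * n₀))) := by
  obtain ⟨n, rfl⟩ := Nat.exists_eq_add_of_le' ht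
  -- `l = ±4ε` minimizes the exponent `l ^ 2 / 8 - |l| * ε` of the Chernoff bound.
  have hexp := measure_exp_le_prod_Ioc_le (κ := 0) (h.measurable_payoffWeight k m (4 * ε * σ))
    (fun t G hG ↦ by simpa using h.lintegral_mul_payoffWeight_le hP k m _ t hG) 0 n
    (2 * ε ^ 2 * n₀)
  rw [mul_zero, zero_sub] at hexp
  refine le_trans (measure_mono fun ω hω ↦ ?_) hexp
  obtain ⟨hcount, hdev⟩ := hω
  simp only [Set.mem_ofPred_eq, zero_add, prod_payoffWeight]
  refine ENNReal.ofReal_le_ofReal (Real.exp_le_exp.2 ?_)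
  set D := empMean (x · ω) (a · ω) (observedPayoff x a r ω) (n + 1) k m - meanPayoff P k m
  calc 2 * ε ^ 2 * n₀ ≤ 2 * ε ^ 2 * count (x · ω) (a · ω) (n + 1) k m := by gcongr
    _ = count (x · ω) (a · ω) (n + 1) k m * (4 * ε * ε - 2 * ε ^ 2 * σ ^ 2) := by rw [hσ]; ring
    _ ≤ count (x · ω) (a · ω) (n + 1) k m * (4 * ε * (σ * D) - 2 * ε ^ 2 * σ ^ 2) := by gcongr
    _ = _ := by ring

theorem measureReal_deviation_le (h : Interaction Pr P ℱ x a r) (hP : IsPayoffLaw P) (k : Fin K)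
    (m : Fin M) {t : ℕ} (ht : 1 ≤ t) {ε : ℝ} (hε : 0 ≤ ε) (n₀ : ℝ) :
    Pr.real {ω | n₀ ≤ count (x · ω) (a · ω) t k m ∧
        ε ≤ |empMean (x · ω) (a · ω) (observedPayoff x a r ω) t k m - meanPayoff P k m|} ≤
      2 * Real.exp (-(2 * ε ^ 2 * n₀)) := by
  have hsigned : ∀ σ : ℝ, σ ^ 2 = 1 → Pr.real {ω | n₀ ≤ count (x · ω) (a · ω) t k m ∧ ε ≤ σ *
      (empMean (x · ω) (a · ω) (observedPayoff x a r ω) t k m - meanPayoff P k m)} ≤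
        Real.exp (-(2 * ε ^ 2 * n₀)) := fun σ hσ ↦
    ENNReal.toReal_le_of_le_ofReal (Real.exp_pos _).le
      (h.measure_signed_deviation_le hP k m ht hε hσ n₀)
  rw [two_mul]
  refine le_trans (measureReal_mono fun ω hω ↦ ?_) ((measureReal_union_le _ _).trans
    (add_le_add (hsigned 1 (one_pow 2)) (hsigned (-1) neg_one_sq)))
  rcases le_abs.1 hω.2 with hpos | hneg
  · exact Or.inl ⟨hω.1, by rwa [one_mul]⟩
  · exact Or.inr ⟨hω.1, by rwa [neg_one_mul]⟩

theorem measureReal_card_arrivals_le (h : Interaction Pr P ℱ x a r) (k : Fin K) (b n : ℕ)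
    (B : ℝ) :
    Pr.real {ω | (#{u ∈ Ioc b (b + n) | x u ω = k} : ℝ) ≤ B} ≤ Real.exp (B - n / (2 * K)) := by
  have hmeas : ∀ t, Measurable[ℱ (t + 1)] (arrivalWeight x k (t + 1)) := fun t ↦
    (measurable_arrivalWeight x k t).mono (h.context_measurable t).comap_le le_rfl
  have hexp := measure_exp_le_prod_Ioc_le hmeas
    (fun t _ hG ↦ h.lintegral_mul_arrivalWeight_le k t hG) b n (-B)
  simp_rw [prod_arrivalWeight] at hexp
  refine ENNReal.toReal_le_of_le_ofReal (Real.exp_pos _).le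
    ((measure_mono fun ω hω ↦ ?_).trans (hexp.trans_eq ?_))
  · exact ENNReal.ofReal_le_ofReal (Real.exp_le_exp.2 (neg_le_neg hω))
  · congr 2
    ring

theorem measureReal_inaccurate_le (h : Interaction Pr P ℱ x a r) (hP : IsPayoffLaw P) {δ : ℝ}
    (hδ : 0 < δ) (k : Fin K) (m : Fin M) {t : ℕ} (ht : 1 ≤ t) :
    Pr.real {ω | threshold δ t / 2 ≤ count (x · ω) (a · ω) t k m ∧
        δ / 4 ≤ |empMean (x · ω) (a · ω) (observedPayoff x a r ω) t k m - meanPayoff P k m|} ≤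
      2 * ((t : ℝ) ^ 2)⁻¹ := by
  refine (h.measureReal_deviation_le hP k m ht (by positivity) _).trans_eq ?_
  have hexponent : 2 * (δ / 4) ^ 2 * (threshold δ t / 2) = Real.log ((t : ℝ) ^ 2) := by
    rw [threshold, Real.log_pow]
    field_simp
    ring
  rw [hexponent, Real.exp_neg, Real.exp_log (by positivity)]

theorem measureReal_recentArrivals_le (h : Interaction Pr P ℱ x a r) (k : Fin K) {t : ℕ}
    (ht : 4 ≤ t) {b : ℝ} (hb : 8 * K * (b + 2 * Real.log t) ≤ t) :
    Pr.real {ω | (recentArrivals (x · ω) t k : ℝ) ≤ b} ≤ ((t : ℝ) ^ 2)⁻¹ := by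
  obtain ⟨n, hn⟩ : ∃ n, t = t / 2 + n + 1 := ⟨t - 1 - t / 2, by lia⟩
  have hslots : Ioo (t / 2) t = Ioc (t / 2) (t / 2 + n) := by
    ext u
    simp only [mem_Ioo, mem_Ioc]
    lia
  have hK : (0 : ℝ) < K := mod_cast k.pos
  have hn4 : (t : ℝ) ≤ 4 * n := mod_cast (by lia : t ≤ 4 * n)
  have hexponent : b - n / (2 * K) ≤ -Real.log ((t : ℝ) ^ 2) := by
    have hmean : b + 2 * Real.log t ≤ n / (2 * K) := by
      rw [le_div_iff₀ (by positivity)]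
      linarith
    rw [Real.log_pow, Nat.cast_ofNat]
    linarith
  unfold recentArrivals
  rw [hslots]
  calc _ ≤ Real.exp (b - n / (2 * K)) := h.measureReal_card_arrivals_le k _ n b
    _ ≤ Real.exp (-Real.log ((t : ℝ) ^ 2)) := Real.exp_le_exp.2 hexponent
    _ = ((t : ℝ) ^ 2)⁻¹ := by rw [Real.exp_neg, Real.exp_log (by positivity)]

theorem measureReal_not_isGoodSlot_le (h : Interaction Pr P ℱ x a r) (hP : IsPayoffLaw P)
    {δ : ℝ} (hδ : 0 < δ) {R : Fin K → Finset (Fin M)} {ρ : ℝ} (hR : ∀ k, #(R k) ≤ ρ) {t : ℕ}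
    (ht : 4 ≤ t) {b : ℝ} (hb : 8 * K * (b + 2 * Real.log t) ≤ t) :
    Pr.real {ω | ¬IsGoodSlot δ (meanPayoff P) R b (x · ω) (a · ω) (observedPayoff x a r ω) t} ≤
      K * (2 * ρ + 1) * ((t : ℝ) ^ 2)⁻¹ := by
  set Inacc : Fin K → Fin M → Set Ω := fun k m ↦
    {ω | threshold δ t / 2 ≤ count (x · ω) (a · ω) t k m ∧
      δ / 4 ≤ |empMean (x · ω) (a · ω) (observedPayoff x a r ω) t k m - meanPayoff P k m|}
  set Rare : Fin K → Set Ω := fun k ↦ {ω | (recentArrivals (x · ω) t k : ℝ) ≤ b}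
  have hcover : {ω | ¬IsGoodSlot δ (meanPayoff P) R b (x · ω) (a · ω) (observedPayoff x a r ω) t} ⊆
      ⋃ k, ((⋃ m ∈ R k, Inacc k m) ∪ Rare k) := by
    intro ω hbad
    by_contra! hgood
    simp only [Set.mem_iUnion, Set.mem_union, not_exists, not_or] at hgood
    exact hbad ⟨fun k m hm hcount ↦ not_le.1 fun hdev ↦ (hgood k).1 m hm ⟨hcount, hdev⟩,
      fun k ↦ not_le.1 (hgood k).2⟩
  have hcontext : ∀ k, Pr.real ((⋃ m ∈ R k, Inacc k m) ∪ Rare k) ≤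
      (2 * ρ + 1) * ((t : ℝ) ^ 2)⁻¹ := fun k ↦
    calc Pr.real ((⋃ m ∈ R k, Inacc k m) ∪ Rare k)
        ≤ ∑ m ∈ R k, Pr.real (Inacc k m) + Pr.real (Rare k) :=
          (measureReal_union_le _ _).trans
            (add_le_add_left (measureReal_biUnion_finset_le _ _) _)
      _ ≤ ∑ _m ∈ R k, 2 * ((t : ℝ) ^ 2)⁻¹ + ((t : ℝ) ^ 2)⁻¹ := by
          gcongr with m
          · exact h.measureReal_inaccurate_le hP hδ k m (by lia)
          · exact h.measureReal_recentArrivals_le k ht hb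
      _ = (2 * #(R k) + 1) * ((t : ℝ) ^ 2)⁻¹ := by
          rw [sum_const, nsmul_eq_mul]
          ring
      _ ≤ (2 * ρ + 1) * ((t : ℝ) ^ 2)⁻¹ := by
          gcongr
          exact hR k
  calc _ ≤ Pr.real (⋃ k, ((⋃ m ∈ R k, Inacc k m) ∪ Rare k)) := measureReal_mono hcover
    _ ≤ ∑ k, Pr.real ((⋃ m ∈ R k, Inacc k m) ∪ Rare k) := measureReal_iUnion_fintype_le _
    _ ≤ ∑ _k : Fin K, (2 * ρ + 1) * ((t : ℝ) ^ 2)⁻¹ := sum_le_sum fun k _ ↦ hcontext k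
    _ = K * (2 * ρ + 1) * ((t : ℝ) ^ 2)⁻¹ := by
        rw [sum_const, card_univ, Fintype.card_fin, nsmul_eq_mul]
        ring

theorem integral_observedPayoff (h : Interaction Pr P ℱ x a r) (hP : IsPayoffLaw P) (t : ℕ) :
    ∫ ω, observedPayoff x a r ω (t + 1) ∂Pr =
      ∫ ω, meanPayoff P (x (t + 1) ω) (a (t + 1) ω) ∂Pr := by
  refine (integral_select_eq_of_indep (J := fun ω ↦ (x (t + 1) ω, a (t + 1) ω))
    (f := fun p ↦ r (t + 1) p.1 p.2) ((h.information_le t).trans (ℱ.le _)) (fun p ↦ ?_)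
    (fun p ↦ h.measurable_payoff t p.1 p.2) (fun p ↦ h.integrable_payoff hP t p.1 p.2)
    fun p ↦ h.payoff_indep t p.1 p.2).trans ?_
  · simpa only [Set.preimage, Set.mem_singleton_iff, Prod.ext_iff] using
      h.measurableSet_play t p.1 p.2
  · simp_rw [h.integral_payoff]

theorem integrable_gap (h : Interaction Pr P ℱ x a r) {t : ℕ} (ht : 1 ≤ t) :
    Integrable (fun ω ↦ (⨆ m, meanPayoff P (x t ω) m) - meanPayoff P (x t ω) (a t ω)) Pr := by
  obtain ⟨n, rfl⟩ := Nat.exists_eq_add_of_le' ht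
  exact h.integrable_select_play n (f := fun k m _ ↦ (⨆ m', meanPayoff P k m') - meanPayoff P k m)
    fun _ _ ↦ integrable_const _

theorem regret_eq (h : Interaction Pr P ℱ x a r) (hP : IsPayoffLaw P) (T : ℕ) :
    regret Pr P x a r T = ∫ ω, ∑ t ∈ Icc 1 T,
      ((⨆ m, meanPayoff P (x t ω) m) - meanPayoff P (x t ω) (a t ω)) ∂Pr := by
  have hmax : ∀ n, Integrable (fun ω ↦ ⨆ m, meanPayoff P (x (n + 1) ω) m) Pr := fun n ↦
    h.integrable_select_play n (f := fun k _ _ ↦ ⨆ m', meanPayoff P k m')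
      fun _ _ ↦ integrable_const _
  have hmean : ∀ n, Integrable (fun ω ↦ meanPayoff P (x (n + 1) ω) (a (n + 1) ω)) Pr := fun n ↦
    h.integrable_select_play n (f := fun k m _ ↦ meanPayoff P k m) fun _ _ ↦ integrable_const _
  have hobs : ∀ n, Integrable (observedPayoff x a r · (n + 1)) Pr := fun n ↦
    h.integrable_select_play n (h.integrable_payoff hP n)
  have hslot : ∀ t ∈ Icc 1 T,
      Integrable (fun ω ↦ (⨆ m, meanPayoff P (x t ω) m) - observedPayoff x a r ω t) Pr ∧
        ∫ ω, ((⨆ m, meanPayoff P (x t ω) m) - observedPayoff x a r ω t) ∂Pr =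
          ∫ ω, ((⨆ m, meanPayoff P (x t ω) m) - meanPayoff P (x t ω) (a t ω)) ∂Pr := by
    intro t ht
    obtain ⟨n, rfl⟩ := Nat.exists_eq_add_of_le' (mem_Icc.1 ht).1
    refine ⟨(hmax n).sub (hobs n), ?_⟩
    rw [integral_sub (hmax n) (hobs n), integral_sub (hmax n) (hmean n),
      h.integral_observedPayoff hP n]
  unfold regret
  simp_rw [← sum_sub_distrib]
  rw [integral_finsetSum _ fun t ht ↦ h.integrable_gap (mem_Icc.1 ht).1]
  exact (integral_finsetSum _ fun t ht ↦ (hslot t ht).1).trans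
    (sum_congr rfl fun t ht ↦ (hslot t ht).2)

end Interaction

end

/-! ### Covering designs -/

theorem card_filter_mod_eq_le (M g i : ℕ) : #{m : Fin M | m % g = i} ≤ M / g + 1 := by
  rw [← card_range (M / g + 1)]
  refine card_le_card_of_injOn (fun m : Fin M ↦ m / g) (fun m _ ↦ ?_) fun m₁ h₁ m₂ h₂ hdiv ↦ ?_
  · exact mem_coe.2 (mem_range.2 (Nat.lt_succ_of_le (Nat.div_le_div_right m.2.le)))
  · have hmod : (m₁ : ℕ) % g = m₂ % g := (mem_filter.1 h₁).2.trans (mem_filter.1 h₂).2.symm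
    have hdiv' : (m₁ : ℕ) / g = m₂ / g := hdiv
    exact Fin.ext (by rw [← Nat.div_add_mod m₁ g, ← Nat.div_add_mod m₂ g, hmod, hdiv'])

theorem exists_coversPairs (K M : ℕ) {g : ℕ} (hg : 0 < g) (hgK : g * g ≤ K) :
    ∃ (S : Fin K → Finset (Fin M)) (s : ℕ), CoversPairs S s ∧ s ≤ 2 * (M / g + 1) := by
  -- The residues mod `g` split the messages into `g` groups; set `k` unites the groups `k / g` and
  -- `k % g`, and is padded, as all sets must have the same size.
  have hcard : ∀ k : Fin K, #{m : Fin M | m % g = k / g ∨ m % g = k % g} ≤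
      min M (2 * (M / g + 1)) := by
    intro k
    refine le_min ((card_filter_le _ _).trans_eq (card_fin M)) ?_
    rw [filter_or, two_mul]
    exact (card_union_le _ _).trans
      (add_le_add (card_filter_mod_eq_le M g _) (card_filter_mod_eq_le M g _))
  choose S hsub hS using fun k ↦ exists_superset_card_eq (hcard k)
    ((min_le_left _ _).trans_eq (Fintype.card_fin M).symm)
  refine ⟨S, _, ⟨hS, fun m₁ m₂ _ ↦ ?_⟩, min_le_right _ _⟩
  have h₁ := Nat.mod_lt m₁ hg
  have h₂ := Nat.mod_lt m₂ hg
  have hk : g * (m₁ % g) + m₂ % g < K := by nlinarith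
  refine ⟨⟨_, hk⟩, hsub _ (mem_filter.2 ⟨mem_univ _, Or.inl ?_⟩),
    hsub _ (mem_filter.2 ⟨mem_univ _, Or.inr ?_⟩)⟩
  · rw [Nat.mul_add_div hg, Nat.div_eq_of_lt h₂, add_zero]
  · rw [Nat.mul_add_mod, Nat.mod_mod]

theorem half_le_log {y : ℝ} (hy : 2 ≤ y) : 1 / 2 ≤ Real.log y := by
  have hmono : Real.log 2 ≤ Real.log y := Real.log_le_log two_pos hy
  linarith [Real.log_two_gt_d9]

theorem div_natSqrt_le {K M : ℕ} (hK : 0 < K) (hM : 2 ≤ M) :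
    (M : ℝ) / K.sqrt ≤ 4 * (M * √(Real.log (M * K) / K)) := by
  have hg : (1 : ℝ) ≤ K.sqrt := mod_cast Nat.sqrt_pos.2 hK
  have hK1 : (1 : ℝ) ≤ K := mod_cast hK
  have hM2 : (2 : ℝ) ≤ M := mod_cast hM
  have hsqrt : √K ≤ 2 * K.sqrt := by linarith [Real.real_sqrt_lt_nat_sqrt_succ (a := K)]
  have hlog : 1 / 2 ≤ √(Real.log (M * K)) :=
    Real.le_sqrt_of_sq_le (by linarith [half_le_log (y := M * K) (by nlinarith)])
  rw [Real.sqrt_div' _ K.cast_nonneg, ← mul_div_assoc, ← mul_div_assoc,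
    div_le_div_iff₀ (by positivity) (by positivity)]
  calc M * √K ≤ M * (2 * K.sqrt) := by gcongr
    _ = 4 * (M * (1 / 2)) * K.sqrt := by ring
    _ ≤ 4 * (M * √(Real.log (M * K))) * K.sqrt := by gcongr

theorem IsPairAllocation.card_le {S : Fin K → Finset (Fin M)} {c : Sym2 (Fin M) → Fin K}
    (hS : IsPairAllocation S c) (k : Fin K) :
    (#(S k) : ℝ) ≤ 8 * (M * √(Real.log (M * K) / K)) + 2 := by
  obtain ⟨⟨s, ⟨hcard, -⟩, hmin⟩, -⟩ := hS
  rw [hcard k]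
  rcases lt_or_ge M 2 with hM | hM
  · have hempty : CoversPairs (fun _ : Fin K ↦ (∅ : Finset (Fin M))) 0 :=
      ⟨fun _ ↦ card_empty, fun m₁ m₂ hne ↦ absurd (Fin.ext (by lia)) hne⟩
    rw [Nat.le_zero.1 (hmin _ 0 hempty)]
    push_cast
    positivity
  · obtain ⟨S', s', hS', hs'⟩ :=
      exists_coversPairs K M (Nat.sqrt_pos.2 k.pos) (Nat.sqrt_le K)
    calc (s : ℝ) ≤ 2 * ((M / K.sqrt : ℕ) + 1) := mod_cast (hmin S' s' hS').trans hs'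
      _ ≤ 2 * (M / K.sqrt + 1) := by gcongr; exact Nat.cast_div_le
      _ ≤ 8 * (M * √(Real.log (M * K) / K)) + 2 := by linarith [div_natSqrt_le k.pos hM]

/-! ### The regret bound -/

theorem sum_Ioc_inv_sq_le_one {τ : ℕ} (hτ : 1 ≤ τ) (T : ℕ) :
    ∑ t ∈ Ioc τ T, ((t : ℝ) ^ 2)⁻¹ ≤ 1 := by
  have hIoo : Ioc τ T = Ioo τ (T + 1) := by
    ext t
    simp only [mem_Ioc, mem_Ioo, Nat.lt_succ_iff]
  have hτ' : (1 : ℝ) ≤ τ := mod_cast hτ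
  rw [hIoo]
  refine (sum_Ioo_inv_sq_le τ (T + 1)).trans ?_
  rw [div_le_one (by positivity)]
  linarith

theorem IsPayoffLaw.meanPayoff_mem_Icc {P : Fin K → Fin M → Measure ℝ} (hP : IsPayoffLaw P)
    (k : Fin K) (m : Fin M) : meanPayoff P k m ∈ Set.Icc 0 1 := by
  obtain ⟨hprob, hIcc⟩ := hP k m
  exact (convex_Icc 0 1).integral_mem isClosed_Icc hIcc
    (Integrable.of_mem_Icc 0 1 aemeasurable_id hIcc)

section

variable {Ω : Type*} {mΩ : MeasurableSpace Ω} {Pr : Measure Ω} [IsProbabilityMeasure Pr]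
  {P : Fin K → Fin M → Measure ℝ} {ℱ : Filtration ℕ mΩ} {x : ℕ → Ω → Fin K} {a : ℕ → Ω → Fin M}
  {r : ℕ → Fin K → Fin M → Ω → ℝ} {δ : ℝ} {S : Fin K → Finset (Fin M)}
  {c : Sym2 (Fin M) → Fin K} {rep : Finset (Finset (Fin M)) → Finset (Fin M)} {ι : Type*}
  {ty : Fin M → ι} {T : ℕ}
  (h : Interaction Pr P ℱ x a r) (hP : IsPayoffLaw P) (hδ : 0 < δ)
  (hμ : HasTypeGap (meanPayoff P) ty δ) (hS : IsPairAllocation S c)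
  (hrep : IsRepresentativeRule rep)
  (halg : ∀ᵐ ω ∂Pr, ∀ t, 1 ≤ t →
    AlgorithmStep δ S c rep (x · ω) (a · ω) (observedPayoff x a r ω) t)
include h hP hδ hμ hS hrep halg

theorem regret_le_of_late {b ρ : ℝ} (hb : ∀ k, #(S k) * (threshold δ T + 1) ≤ b)
    (hρ : ∀ k, #(candidates S rep ty k) ≤ ρ) {τ : ℕ} (hτ : 4 ≤ τ)
    (hlate : 8 * K * (b + 2 * Real.log T) ≤ τ) :
    regret Pr P x a r T ≤ τ + K * (ρ * (threshold δ T + 1)) + K * (2 * ρ + 1) := by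
  classical
  set R := candidates S rep ty
  have : Nonempty Ω := nonempty_of_isProbabilityMeasure Pr
  have hρ0 : 0 ≤ ρ := (Nat.cast_nonneg _).trans (hρ (x 0 (Classical.arbitrary Ω)))
  set Bad : ℕ → Set Ω := fun t ↦
    {ω | ¬IsGoodSlot δ (meanPayoff P) R b (x · ω) (a · ω) (observedPayoff x a r ω) t}
  have hgap : ∀ᵐ ω ∂Pr, ∑ t ∈ Icc 1 T,
      ((⨆ m, meanPayoff P (x t ω) m) - meanPayoff P (x t ω) (a t ω)) ≤
        τ + ∑ k, #(R k) * (threshold δ T + 1) + #{t ∈ Ioc τ T | ω ∈ Bad t} := by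
    filter_upwards [halg] with ω hω
    exact sum_gap_le hμ hS hrep hω hb hP.meanPayoff_mem_Icc (by lia)
  have hcand : ∑ k, #(R k) * (threshold δ T + 1) ≤ K * (ρ * (threshold δ T + 1)) := by
    refine (sum_le_card_nsmul _ _ (ρ * (threshold δ T + 1)) fun k _ ↦ ?_).trans_eq (by simp)
    exact mul_le_mul_of_nonneg_right (hρ k) (add_nonneg (threshold_nonneg δ T) zero_le_one)
  have hbad : ∀ t ∈ Ioc τ T, Pr.real (Bad t) ≤ K * (2 * ρ + 1) * ((t : ℝ) ^ 2)⁻¹ := by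
    intro t ht
    obtain ⟨hτt, htT⟩ := mem_Ioc.1 ht
    refine h.measureReal_not_isGoodSlot_le hP hδ hρ (by lia) (le_trans ?_ (hlate.trans ?_))
    · gcongr
      exact_mod_cast (by lia : 0 < t)
    · exact_mod_cast hτt.le
  calc regret Pr P x a r T
      ≤ τ + ∑ k, #(R k) * (threshold δ T + 1) + ∑ t ∈ Ioc τ T, Pr.real (Bad t) := by
        rw [h.regret_eq hP T]
        exact integral_le_add_sum_measureReal
          (integrable_finsetSum _ fun t ht ↦ h.integrable_gap (mem_Icc.1 ht).1) _ _ hgap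
    _ ≤ τ + K * (ρ * (threshold δ T + 1)) +
          K * (2 * ρ + 1) * ∑ t ∈ Ioc τ T, ((t : ℝ) ^ 2)⁻¹ := by
        rw [mul_sum]
        gcongr with t ht
        exact hbad t ht
    _ ≤ τ + K * (ρ * (threshold δ T + 1)) + K * (2 * ρ + 1) * 1 := by
        gcongr
        exact sum_Ioc_inv_sq_le_one (by lia) T
    _ = _ := by rw [mul_one]

theorem regret_le_of_card_le [Fintype ι] {σ : ℝ} (hσ : ∀ k, #(S k) ≤ σ) (hT : 2 ≤ T) :
    regret Pr P x a r T ≤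
      (288 / δ ^ 2 + 48) * (K * (σ + Fintype.card ι)) * Real.log T := by
  have : Nonempty Ω := nonempty_of_isProbabilityMeasure Pr
  have ω : Ω := Classical.arbitrary Ω
  have hK : (1 : ℝ) ≤ K := mod_cast (x 0 ω).pos
  have hL : (1 : ℝ) ≤ Fintype.card ι := mod_cast Fintype.card_pos_iff.2 ⟨ty (a 0 ω)⟩
  have hσ0 : 0 ≤ σ := (Nat.cast_nonneg _).trans (hσ (x 0 ω))
  have hlog : 1 / 2 ≤ Real.log T := half_le_log (mod_cast hT)
  have hD := threshold_nonneg δ T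
  set D := threshold δ T with hDdef
  set L := (Fintype.card ι : ℝ)
  set τ₀ : ℝ := 8 * K * (σ * (D + 1) + 2 * Real.log T)
  have hcand : ∀ k, (#(candidates S rep ty k) : ℝ) ≤ σ + L := fun k ↦
    (Nat.cast_le.2 (hrep.card_candidates_le S ty k)).trans
      (by rw [Nat.cast_add]; exact add_le_add_left (hσ k) L)
  have hτ₀ : 0 ≤ τ₀ := by positivity
  have hregret := regret_le_of_late h hP hδ hμ hS hrep halg (b := σ * (D + 1))
    (fun k ↦ by gcongr; exact hσ k) hcand (τ := ⌊τ₀⌋₊ + 4) (by lia)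
    (by push_cast; linarith [Nat.lt_floor_add_one τ₀])
  have hτ : ((⌊τ₀⌋₊ + 4 : ℕ) : ℝ) ≤ τ₀ + 4 := by
    push_cast
    linarith [Nat.floor_le hτ₀]
  set W := K * (σ + L)
  have hKW : (K : ℝ) ≤ W := le_mul_of_one_le_right (by positivity) (by linarith)
  have hσW : K * σ ≤ W := mul_le_mul_of_nonneg_left (by linarith) K.cast_nonneg
  have hτ₀W : τ₀ ≤ 8 * W * (D + 1) + 16 * W * Real.log T :=
    calc τ₀ = 8 * (K * σ) * (D + 1) + 16 * K * Real.log T := by ring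
      _ ≤ 8 * W * (D + 1) + 16 * W * Real.log T := by gcongr
  calc regret Pr P x a r T
      ≤ τ₀ + 4 + K * ((σ + L) * (D + 1)) + K * (2 * (σ + L) + 1) := by linarith
    _ = τ₀ + 4 + W * (D + 1) + 2 * W + K := by ring
    _ ≤ W * (9 * D + 16 * Real.log T + 16) := by linarith
    _ ≤ W * (9 * D + 48 * Real.log T) := by gcongr W * ?_; linarith
    _ = (288 / δ ^ 2 + 48) * W * Real.log T := by
        rw [hDdef, threshold]
        ring

end

end LatentBandit

end

theorem theorem3_general {K M : ℕ} {P : Fin K → Fin M → MeasureTheory.Measure ℝ} {δ : ℝ}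
    {ι : Type*} [Fintype ι] {ty : Fin M → ι} {S : Fin K → Finset (Fin M)}
    {c : Sym2 (Fin M) → Fin K} {rep : Finset (Finset (Fin M)) → Finset (Fin M)}
    {Ω : Type*} {mΩ : MeasurableSpace Ω} {Pr : MeasureTheory.Measure Ω}
    [MeasureTheory.IsProbabilityMeasure Pr] {ℱ : MeasureTheory.Filtration ℕ mΩ}
    {x : ℕ → Ω → Fin K} {a : ℕ → Ω → Fin M} {r : ℕ → Fin K → Fin M → Ω → ℝ} {T : ℕ}
    (hP : LatentBandit.IsPayoffLaw P) (hδ : 0 < δ)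
    (hμ : LatentBandit.HasTypeGap (LatentBandit.meanPayoff P) ty δ)
    (hS : LatentBandit.IsPairAllocation S c) (hrep : LatentBandit.IsRepresentativeRule rep)
    (h : LatentBandit.Interaction Pr P ℱ x a r)
    (halg : ∀ᵐ ω ∂Pr, ∀ t, 1 ≤ t → LatentBandit.AlgorithmStep δ S c rep
      (x · ω) (a · ω) (LatentBandit.observedPayoff x a r ω) t)
    (hT : 2 ≤ T) :
    LatentBandit.regret Pr P x a r T ≤ 8 * (288 / δ ^ 2 + 48) *
      (K * M * √(Real.log (M * K) / K) + K * Fintype.card ι) * Real.log T := by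
  obtain ⟨ω⟩ := MeasureTheory.nonempty_of_isProbabilityMeasure Pr
  have hL : (1 : ℝ) ≤ Fintype.card ι := mod_cast Fintype.card_pos_iff.2 ⟨ty (a 0 ω)⟩
  refine (LatentBandit.regret_le_of_card_le h hP hδ hμ hS hrep halg hS.card_le hT).trans ?_
  set Q := √(Real.log (M * K) / K)
  have hsize : K * (8 * (M * Q) + 2 + Fintype.card ι) ≤ 8 * (K * M * Q + K * Fintype.card ι) :=
    calc K * (8 * (M * Q) + 2 + Fintype.card ι)
        ≤ K * (8 * (M * Q) + 8 * Fintype.card ι) := by gcongr ?_ * ?_; linarith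
      _ = 8 * (K * M * Q + K * Fintype.card ι) := by ring
  calc _ ≤ (288 / δ ^ 2 + 48) * (8 * (K * M * Q + K * Fintype.card ι)) * Real.log T := by gcongr
    _ = _ := by ring

theorem theorem3 (δ : ℝ) (hδ : 0 < δ) :
    ∃ C : ℝ, ∀ (K M L : ℕ)
      (P : Fin K → Fin M → MeasureTheory.Measure ℝ) (Δ : ℝ) (ty : Fin M → Fin L)
      (_ : LatentBandit.IsPayoffLaw P) (_ : δ ≤ Δ)
      (_ : LatentBandit.DiscretePayoffs (LatentBandit.meanPayoff P) Δ)
      (_ : LatentBandit.LatentTypes (LatentBandit.meanPayoff P) ty)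
      (S : Fin K → Finset (Fin M)) (c : Sym2 (Fin M) → Fin K)
      (rep : Finset (Finset (Fin M)) → Finset (Fin M))
      (_ : LatentBandit.IsPairAllocation S c) (_ : LatentBandit.IsRepresentativeRule rep)
      (Ω : Type*) (mΩ : MeasurableSpace Ω) (Pr : MeasureTheory.Measure Ω)
      (_ : MeasureTheory.IsProbabilityMeasure Pr) (ℱ : MeasureTheory.Filtration ℕ mΩ)
      (x : ℕ → Ω → Fin K) (a : ℕ → Ω → Fin M) (r : ℕ → Fin K → Fin M → Ω → ℝ)
      (_ : LatentBandit.Interaction Pr P ℱ x a r)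
      (_ : ∀ᵐ ω ∂Pr, ∀ t : ℕ, 1 ≤ t → LatentBandit.AlgorithmStep δ S c rep
        (fun u => x u ω) (fun u => a u ω) (fun u => r u (x u ω) (a u ω) ω) t)
      (T : ℕ), 2 ≤ T →
      LatentBandit.regret Pr P x a r T ≤
        C * ((K : ℝ) * M * Real.sqrt (Real.log ((M : ℝ) * K) / K) + (K : ℝ) * L) * Real.log T :=
  ⟨8 * (288 / δ ^ 2 + 48),
    fun _ _ _ _ _ _ hP hΔ hμ hty _ _ _ hS hrep _ _ _ _ _ _ _ _ h halg _ hT ↦ by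
      simpa only [Fintype.card_fin] using
        theorem3_general hP hδ (hty.hasTypeGap hμ hδ.le hΔ) hS hrep h halg hT⟩
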